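/- **Setting.** Let $1\le k$, $0\le\nu\le n-k-1$. $n$ non-colluding nodes store $m\ge 1$ files using a given $(n,k)$ MDS code over $GF(q)$. Each file consists of $\alpha$ stripes of $k$ symbols of a finite extension $GF(q^\ell)$; every stripe is encoded with the same generator matrix, so node $l$ stores a vector $W_l\in GF(q^\ell)^{m\alpha}$. In a PIR scheme the user, who wants file $f$ (uniform on the $m$ files), sends randomized queries $Q_l$ that are independent of the data, and the nodes answer as functions of their query and of $W_l$. In a linear scheme, $Q_l$ is a matrix over $GF(q)$ with $m\alpha$ columns and the answer is $Q_lW_l$. Perfect privacy means $H(f\mid Q_l)=H(f)$ for every node $l$. The communication price of privacy (cPoP) is the (expected) number of downloaded symbols divided by the number $k\alpha$ of symbols in a file. **The scheme.** For $0\le i\le\nu$ put $n_i=n-i$, $\alpha_i=\frac{\mathrm{LCM}(k,n_i-k)}{k}$, $d_i'=\frac{\mathrm{LCM}(k,n_i-k)}{n_i-k}$, $\alpha=\mathrm{LCM}(\alpha_0,\dots,\alpha_\nu)$ and $d_i=d_i'\alpha/\alpha_i$. Let $e_a$ be the unit vector at stripe $a$ ($1\le a\le\alpha$) of file $f$. *Layer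 1* consists of $d_0$ subqueries to all nodes, in $\alpha/\alpha_0$ copies of $d_0'$ subqueries; copy $c=0,1,\dots$ uses the stripes $c\alpha_0+1,\dots,(c+1)\alpha_0$. Every subquery $t$ has its own uniform random vector $u_t$ over $GF(q)$. Write $n-k=\beta k+r$ with $0\le r<k$ and $g=\gcd(k,n-k)$. Consider copy $c$ and its $j$-th subquery, $j=1,\dots,d_0'$, which has random vector $u_t$. In the first subquery, node $l\le r$ gets $u_t+e_{c\alpha_0+\lceil l/g\rceil}$ and nodes $r+1,\dots,k$ get $u_t$; in every further subquery this pattern on nodes $1,\dots,k$ is shifted cyclically by $g$ nodes. For $s=1,\dots,\beta$, the nodes $sk+1,\dots,(s+1)k$ get $u_t+e_{c\alpha_0+r/g+(s-1)d_0'+j}$. The last $r$ nodes get $u_t$. *Layer 2*, for a set $S$ of $i\le\nu$ unresponsive nodes: each missing layer-1 response asks for a part, which is $e_a$ if its query was $u_t+e_a$, and $u_t$ if its query was $u_t$. The user divides the $i\,d_0$ missing parts into $d_i-d_0$ groups of size $n_i-k$, one group for each new subquery $s$ with a new uniform random vector $v_s$. In subquery $s$, the parts $x$ of its group are requested from distinct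 responsive nodes by sending $v_s+x$, and the other $k$ responsive nodes get $v_s$. A part is never requested from a node that was already asked for the same part, in layer 1 or in layer 2. **Theorem.** For every set $S$ of at most $\nu$ unresponsive nodes, choices for layer 2 with these properties exist. For any such choices, which may depend on $S$ and $f$, the resulting linear scheme over $GF(q)$ is universally $\nu$-robust: for every set $S$ of $i\le\nu$ unresponsive nodes, file $f$ can be decoded from the answers of the $n_i$ responsive nodes in the two layers, every node $l$ (responsive or not) satisfies $H(f\mid Q_l)=H(f)$, where $Q_l$ collects all queries that node $l$ received, and the communication price of privacy is exactly $$\mathrm{cPoP}=\frac{n_i}{n_i-k}.$$ This is asymptotically optimal: for every such $S$ and every $\varepsilon>0$ there is an $M$ such that, for all $m\ge M$, every PIR scheme for $m$ files stored with the given code and with any number $\alpha\geq 1$ of stripes (linear or not, even if it is designed for this $S$) that is perfectly private and retrieves the requested file with zero error from the answers of the nodes outside $S$ has $\mathrm{cPoP}\ge\frac{n_i}{n_i-k}-\varepsilon$. -/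

import Mathlib

universe u v w

open Finset Matrix

/-! ### Coded storage -/

/-- `G` is a generator matrix of an `(n, k)` MDS code: the least Hamming weight of the encoding of
a nonzero message is `n - k + 1`. (For `k ≤ n` this forces encoding to be injective.) -/
def IsMDS {F : Type u} [Field F] [DecidableEq F] {n k : ℕ} (G : Matrix (Fin k) (Fin n) F) : Prop :=
  IsLeast {d : ℕ | ∃ x : Fin k → F, x ≠ 0 ∧ hammingNorm (x ᵥ* G) = d} (n - k + 1)

/-- The collection of the `m` files: each has `α` stripes, and each stripe has one symbol from each
of the `k` blocks of the file. -/
abbrev Files (K : Type v) (m α k : ℕ) : Type v := Fin m → Fin α → Fin k → K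

/-- The column vector stored on node `l`, of length `m α`: every stripe of every file is encoded
separately with the generator matrix `G`. -/
def stored {F : Type u} {K : Type v} [Field F] [Field K] [Algebra F K] {n k m α : ℕ}
    (G : Matrix (Fin k) (Fin n) F) (X : Files K m α k) (l : Fin n) : Fin m × Fin α → K :=
  fun p => ∑ b, algebraMap F K (G b l) * X p.1 p.2 b

/-! ### Entropy of finite distributions -/

/-- Shannon entropy (in nats) of a probability mass function on a finite set. -/
noncomputable def entropy {A : Type*} [Fintype A] (p : A → ℝ) : ℝ := ∑ a, Real.negMulLog (p a)

/-- Conditional entropy `H(A | B)` of a joint mass function `p a b`: the entropy of the conditional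
law of `A` given `B = b`, averaged over the law of `B`. -/
noncomputable def condEntropy {A B : Type*} [Fintype A] [Fintype B] (p : A → B → ℝ) : ℝ :=
  ∑ b, (∑ a, p a b) * entropy fun a => p a b / ∑ a', p a' b

/-! ### PIR schemes -/

/-- A PIR scheme (not necessarily linear) for `m` files of `α` stripes stored on `n` nodes over the
alphabet `K`. The user draws `ω` with probability `prob ω`, independently of the requested index
`f`, and sends `query f ω l` to node `l`; the node answers with `len l q` symbols computed from the
query `q` and the stored vector. -/
structure PIRScheme (K : Type v) (n m α : ℕ) where
  Ω : Type w
  [fintypeΩ : Fintype Ω]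
  prob : Ω → ℝ
  prob_nonneg : ∀ ω, 0 ≤ prob ω
  prob_sum : ∑ ω, prob ω = 1
  Query : Fin n → Type w
  [fintypeQuery : ∀ l, Fintype (Query l)]
  query : Fin m → Ω → (l : Fin n) → Query l
  len : (l : Fin n) → Query l → ℕ
  answer : (l : Fin n) → (q : Query l) → (Fin m × Fin α → K) → Fin (len l q) → K

attribute [instance] PIRScheme.fintypeΩ PIRScheme.fintypeQuery

namespace PIRScheme

variable {F : Type u} {K : Type v} [Field F] [Field K] [Algebra F K] {n m α k : ℕ}

open Classical in
/-- The joint probability that the requested index is `f` and node `l` receives `q`, when the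
index is uniform on the `m` files and independent of the randomness of the user. -/
noncomputable def joint (P : PIRScheme.{v, w} K n m α) (l : Fin n) (f : Fin m) (q : P.Query l) :
    ℝ :=
  ∑ ω, if P.query f ω l = q then P.prob ω / m else 0

/-- Perfect privacy against non-colluding nodes: `H(f | Q_l) = H(f)` for every node `l`. -/
def IsPrivate (P : PIRScheme.{v, w} K n m α) : Prop :=
  ∀ l : Fin n, condEntropy (P.joint l) = entropy fun _ : Fin m => 1 / (m : ℝ)

/-- The user, who knows `f` and `ω`, decodes file `f` with zero error from the answers of the
nodes in `R`. -/
def Retrieves (P : PIRScheme.{v, w} K n m α) (G : Matrix (Fin k) (Fin n) F)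
    (R : Finset (Fin n)) : Prop :=
  ∀ (f : Fin m) (ω : P.Ω), P.prob ω ≠ 0 →
    ∃ dec : ((l : {l // l ∈ R}) → Fin (P.len l (P.query f ω l)) → K) → (Fin α → Fin k → K),
      ∀ X : Files K m α k,
        dec (fun l => P.answer l (P.query f ω l) (stored G X l)) = X f

/-- Communication price of privacy when the nodes in `R` respond: the (expected) number of symbols
downloaded from these nodes, divided by the number `k α` of symbols of a file. -/
noncomputable def cPoP (P : PIRScheme.{v, w} K n m α) (k : ℕ) (R : Finset (Fin n)) : ℝ :=
  (∑ l ∈ R, ∑ f, ∑ ω, P.prob ω / m * P.len l (P.query f ω l)) / (k * α)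

end PIRScheme

/-- A linear PIR scheme over `F`: the request sent to node `l` is a matrix over `F` with `rows l`
rows of length `m α`. -/
structure LinearPIRScheme (F : Type u) (n m α : ℕ) where
  Ω : Type u
  [fintypeΩ : Fintype Ω]
  prob : Ω → ℝ
  prob_nonneg : ∀ ω, 0 ≤ prob ω
  prob_sum : ∑ ω, prob ω = 1
  rows : Fin n → ℕ
  query : Fin m → Ω → (l : Fin n) → Matrix (Fin (rows l)) (Fin m × Fin α) F

attribute [instance] LinearPIRScheme.fintypeΩ

/-- A linear scheme as a PIR scheme: a node responds with the projection of its data onto the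
query matrix. -/
def LinearPIRScheme.toPIRScheme {F : Type u} [Field F] [Fintype F] {n m α : ℕ}
    (P : LinearPIRScheme F n m α) (K : Type v) [Field K] [Algebra F K] :
    PIRScheme.{v, u} K n m α where
  Ω := P.Ω
  prob := P.prob
  prob_nonneg := P.prob_nonneg
  prob_sum := P.prob_sum
  Query l := Matrix (Fin (P.rows l)) (Fin m × Fin α) F
  fintypeQuery _ := inferInstanceAs (Fintype (Fin _ → (Fin m × Fin α) → F))
  query := P.query
  len l _ := P.rows l
  answer _ q W := q.map (algebraMap F K) *ᵥ W

/-- `c` is, for large numbers of files, the least price of privacy when the nodes in `R` respond: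
for every `ε > 0`, if there are sufficiently many files then no private PIR scheme, with any number
of stripes, that retrieves the requested file from the nodes in `R` costs less than `c - ε`. -/
def IsAsymptoticLowerBound {F : Type u} (K : Type v) [Field F] [Field K] [Algebra F K] {n k : ℕ}
    (G : Matrix (Fin k) (Fin n) F) (R : Finset (Fin n)) (c : ℝ) : Prop :=
  ∀ ε > 0, ∃ M : ℕ, ∀ m ≥ M, ∀ α > 0, ∀ P : PIRScheme.{v, w} K n m α,
    P.IsPrivate → P.Retrieves G R → c - ε ≤ P.cPoP k R

/-- A family of PIR schemes, one for each set `S` of at most `ν` unresponsive nodes, is universal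
`ν`-robust: with `i = |S|` and `nᵢ = n - i` it is perfectly private, retrieves the file from the
responsive nodes, and has price of privacy `nᵢ / (nᵢ - k)`. -/
def IsUniversalRobust {F : Type u} {K : Type v} [Field F] [Field K] [Algebra F K] {n k m α : ℕ}
    (G : Matrix (Fin k) (Fin n) F) (ν : ℕ)
    (P : (S : Finset (Fin n)) → #S ≤ ν → PIRScheme.{v, w} K n m α) : Prop :=
  ∀ (S : Finset (Fin n)) (hS : #S ≤ ν),
    (P S hS).IsPrivate ∧ (P S hS).Retrieves G Sᶜ ∧
      (P S hS).cPoP k Sᶜ = ((n : ℝ) - #S) / ((n : ℝ) - #S - k)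

/-! ### The two-layer scheme -/

namespace TwoLayer

/-- Number of subdivisions `LCM(k, n - k) / k` of the non-robust scheme. -/
def subdiv (n k : ℕ) : ℕ := Nat.lcm k (n - k) / k

/-- Number of subqueries `LCM(k, n - k) / (n - k)` of the non-robust scheme. -/
def baseDim (n k : ℕ) : ℕ := Nat.lcm k (n - k) / (n - k)

/-- Number of subdivisions of the robust scheme: the least common multiple of
`subdiv (n - i) k` for `i = 0, …, ν`. -/
def alpha (n k ν : ℕ) : ℕ := (range (ν + 1)).lcm fun i => subdiv (n - i) k

/-- Total number `dᵢ` of subqueries when `i` nodes are unresponsive; `dim n k ν 0` is the number of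
subqueries of layer 1. -/
def dim (n k ν i : ℕ) : ℕ := baseDim (n - i) k * (alpha n k ν / subdiv (n - i) k)

/-- What a query asks for on top of its one-time pad: a stripe of the requested file, or one of the
random vectors of layer 1 (numbered from `0`). -/
inductive Part where
  | stripe (a : ℕ)
  | mask (t : ℕ)
  deriving DecidableEq

/-- The part that layer-1 subquery `t` asks from node `l` (both numbered from `0`); `mask t` means
that the random vector `u_t` is sent alone. Layer 1 repeats the non-robust scheme, and `t` is the
`j`-th subquery of copy `c`. Write `n - k = β k + r` and `g = gcd(k, n - k)`. In the first subquery,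
the first `r` of the first `k` nodes ask for the first `r / g` stripes, `g` nodes for each; this
pattern is shifted cyclically by `g` nodes from one subquery to the next. Each of the next `β`
groups of `k` nodes asks for a new stripe in every subquery. The last `r` nodes get `u_t`. -/
def part (n k t l : ℕ) : Part :=
  let r := (n - k) % k
  let β := (n - k) / k
  let g := Nat.gcd k (n - k)
  let d := baseDim n k
  let c := t / d
  let j := t % d
  if l < k then
    let p := (l + (k - j * g)) % k
    if p < r then .stripe (c * subdiv n k + p / g) else .mask t
  else if l < (β + 1) * k then
    .stripe (c * subdiv n k + r / g + (l / k - 1) * d + j)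
  else .mask t

/-- The subresponses of layer 1 that are missing when the nodes in `S` are unresponsive. -/
abbrev Missing (n k ν : ℕ) (S : Finset (Fin n)) : Type := Fin (dim n k ν 0) × {l // l ∈ S}

/-- The part that a missing subresponse is about. -/
def Missing.part {n k ν : ℕ} {S : Finset (Fin n)} (x : Missing n k ν S) : Part :=
  TwoLayer.part n k x.1 x.2.1

/-- The choices made by the user in layer 2: the missing parts are divided into `dᵢ - d₀` groups of
size `nᵢ - k`, one for each new subquery, and every missing part is requested in its subquery from
a responsive node that is asked for nothing else in that subquery and has not been asked for the
same part before, in layer 1 or in layer 2. -/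
structure Plan (n k ν : ℕ) (S : Finset (Fin n)) where
  group : Missing n k ν S → Fin (dim n k ν #S - dim n k ν 0)
  node : Missing n k ν S → {l // l ∉ S}
  card_group : ∀ s, #{x | group x = s} = n - #S - k
  one_per_query : ∀ x y, group x = group y → node x = node y → x = y
  fresh_layer1 : ∀ x (t : Fin (dim n k ν 0)), part n k t (node x).1 ≠ x.part
  fresh_layer2 : ∀ x y, x.part = y.part → node x = node y → x = y

/-- The random vectors `u_t`: those of layer 1 and those of layer 2 for `i` unresponsive nodes. -/
abbrev Masks (F : Type u) (n k ν m i : ℕ) : Type u :=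
  (Fin (dim n k ν 0) → Fin m × Fin (alpha n k ν) → F) ×
    (Fin (dim n k ν i - dim n k ν 0) → Fin m × Fin (alpha n k ν) → F)

variable {F : Type u} [Field F] {n k ν m : ℕ}

/-- The unit vector at stripe `a` of file `f`. -/
def unitVec (F : Type u) [Field F] (m α : ℕ) (f : Fin m) (a : ℕ) : Fin m × Fin α → F :=
  fun p => if p.1 = f ∧ p.2.val = a then 1 else 0

/-- The query of layer 1: it does not depend on the set of unresponsive nodes. -/
def query1 (f : Fin m) (U : Fin (dim n k ν 0) → Fin m × Fin (alpha n k ν) → F)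
    (t : Fin (dim n k ν 0)) (l : Fin n) : Fin m × Fin (alpha n k ν) → F :=
  match part n k t l with
  | .stripe a => U t + unitVec F m (alpha n k ν) f a
  | .mask _ => U t

/-- The vector that is hidden by a new random vector when a missing part is requested: a unit
vector or a random vector of layer 1. -/
def hidden {S : Finset (Fin n)} (f : Fin m)
    (U : Fin (dim n k ν 0) → Fin m × Fin (alpha n k ν) → F) (x : Missing n k ν S) :
    Fin m × Fin (alpha n k ν) → F :=
  match x.part with
  | .stripe a => unitVec F m (alpha n k ν) f a
  | .mask _ => U x.1

open Classical in
/-- The query of layer 2: new subquery `s` sends the new random vector `V s`, plus the hidden vector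
of the missing part, if any, that is requested there from node `l`. -/
noncomputable def query2 {S : Finset (Fin n)} (A : Plan n k ν S) (f : Fin m)
    (U : Fin (dim n k ν 0) → Fin m × Fin (alpha n k ν) → F)
    (V : Fin (dim n k ν #S - dim n k ν 0) → Fin m × Fin (alpha n k ν) → F)
    (s : Fin (dim n k ν #S - dim n k ν 0)) (l : Fin n) : Fin m × Fin (alpha n k ν) → F :=
  if h : ∃ x, A.group x = s ∧ (A.node x).1 = l then V s + hidden f U h.choose else V s

/-- The number of layer-2 subqueries sent to node `l`. -/
def extra (n k ν : ℕ) (S : Finset (Fin n)) (l : Fin n) : ℕ :=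
  if l ∈ S then 0 else dim n k ν #S - dim n k ν 0

theorem extra_le (S : Finset (Fin n)) (l : Fin n) :
    extra n k ν S l ≤ dim n k ν #S - dim n k ν 0 := by
  unfold extra; split_ifs <;> omega

/-- The two-layer scheme when the nodes in `S` are unresponsive, with choices `A f` in layer 2 when
file `f` is requested. All random vectors are independent and uniform. Unresponsive nodes receive
the queries of layer 1 only. -/
noncomputable def scheme [Fintype F] (S : Finset (Fin n)) (A : Fin m → Plan n k ν S) :
    LinearPIRScheme F n m (alpha n k ν) where
  Ω := Masks F n k ν m #S
  prob _ := 1 / (Nat.card (Masks F n k ν m #S) : ℝ)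
  prob_nonneg _ := by positivity
  prob_sum := by
    rw [Finset.sum_const, Finset.card_univ, ← Nat.card_eq_fintype_card, nsmul_eq_mul,
      mul_one_div_cancel]
    exact_mod_cast Nat.card_pos.ne'
  rows l := dim n k ν 0 + extra n k ν S l
  query f ω l := Matrix.of <| Fin.addCases (fun t => query1 f ω.1 t l)
    (fun s => query2 (A f) f ω.1 ω.2 (Fin.castLE (extra_le S l) s) l)

end TwoLayer

/-!
Let `N = n - |S|` be the number of responsive nodes.

**The scheme works.** In layer 1 every part, that is every stripe of the requested file and every
random vector, is requested from exactly `k` different nodes. Parts lost with the unresponsive nodes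
are requested in layer 2 from fresh responsive nodes, so that in the end every part is again
projected on by `k` different responsive nodes (`TwoLayer.informants`). Any `k` symbols of an MDS
codeword determine it, also over the extension field (`IsMDS.eq_zero_of_forall_mem`). Hence the user
decodes first the random vectors of layer 2, each of which is sent alone to `k` responsive nodes,
then those of layer 1, and then the stripes (`TwoLayer.unitVec_eq_zero_of_answers`). All queries of
one node are the image of the independent uniform random vectors under a bijection
(`TwoLayer.maskEquiv`), so their law does not depend on the file, which is what privacy means
(`PIRScheme.isPrivate_iff`).

**The choices of layer 2 exist.** There are `(N - k) * D` missing parts for `D` new subqueries.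
Responsive nodes are chosen greedily, at most `D` parts for each: when a part is placed, at most
`k - 1` nodes are excluded by requests for the same part and at most `N - k - 1` nodes are full
(`TwoLayer.exists_node_assignment`). Listing the parts node by node and dealing them out cyclically
to the new subqueries gives groups of size `N - k` without repeated nodes
(`TwoLayer.exists_balanced_groups`).

**The price is optimal.** Take the files uniform and independent, and let `E j` be the expected sum,
over the responsive nodes, of the entropies of the individual answers given the first `j` files. By
privacy it does not depend on the requested file. When file `j` is requested, the answers determine
it, and given the first `j + 1` files the data on any `k` nodes are independent; with `L` the
entropy of a file this gives `E j ≥ L + (k / N) * E (j + 1)`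
(`PIRScheme.meanReplyEntropy_step`). So the expected download is at least
`L * ∑ i < m, (k / N) ^ i`, and the sum tends to `N / (N - k)`.
The entropy inequalities that are needed, submodularity above all, are proved for functions on a
finite set with the uniform distribution.
-/

/-! ### Entropy of functions on a uniform finite probability space -/

namespace UniformEntropy

variable {X : Type*} [Fintype X] {A B C : Type*}

open Classical in
/-- The size of the fibre of `g` through `x`. -/
noncomputable def fiberCard (g : X → A) (x : X) : ℕ := #{y | g y = g x}

/-- The Shannon entropy (in nats) of `g x` for `x` uniform on the finite type `X`, written as the
mean of `log (|X| / |g⁻¹ (g x)|)`. This form needs no finiteness of the codomain. -/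
noncomputable def H (g : X → A) : ℝ :=
  (∑ x, Real.log (Fintype.card X / fiberCard g x)) / Fintype.card X

/-- The entropy of `g x` conditional on `c x`, for `x` uniform on `X`. -/
noncomputable def condH (g : X → A) (c : X → C) : ℝ := H (fun x => (g x, c x)) - H c

theorem fiberCard_pos (g : X → A) (x : X) : 0 < fiberCard g x :=
  Finset.card_pos.2 ⟨x, by simp⟩

theorem fiberCard_congr (g : X → A) {x y : X} (h : g x = g y) : fiberCard g x = fiberCard g y := by
  unfold fiberCard; rw [h]

theorem H_mono {g : X → A} {g' : X → B} (h : ∀ x y, g' x = g' y → g x = g y) : H g ≤ H g' := by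
  unfold H
  gcongr with x
  · have := fiberCard_pos g x
    have : Nonempty X := ⟨x⟩
    have := Fintype.card_pos (α := X)
    positivity
  · exact_mod_cast fiberCard_pos g' x
  · exact Finset.card_le_card fun y => by simpa using h y x

theorem H_congr {g : X → A} {g' : X → B} (h : ∀ x y, g' x = g' y ↔ g x = g y) : H g = H g' :=
  le_antisymm (H_mono fun x y => (h x y).1) (H_mono fun x y => (h x y).2)

theorem fiberCard_eq_card [DecidableEq A] (g : X → A) (x : X) :
    fiberCard g x = #{y | g y = g x} := by
  unfold fiberCard; congr

theorem sum_inv_fiberCard_le_one [DecidableEq A] (g : X → A) (a : A) :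
    ∑ x with g x = a, (1 : ℝ) / fiberCard g x ≤ 1 := by
  have : ∑ x with g x = a, (1 : ℝ) / fiberCard g x
      = ∑ x with g x = a, (1 : ℝ) / #{y | g y = a} := by
    refine Finset.sum_congr rfl fun x hx => ?_
    simp only [Finset.mem_filter, Finset.mem_univ, true_and] at hx
    rw [fiberCard_eq_card, hx]
  rw [this, Finset.sum_const, nsmul_eq_mul, mul_one_div]
  exact div_self_le_one _

theorem H_le_log_card [Fintype A] (g : X → A) : H g ≤ Real.log (Fintype.card A) := by
  classical
  rcases isEmpty_or_nonempty X with hX | ⟨⟨x₀⟩⟩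
  · simp only [H, Finset.univ_eq_empty, Finset.sum_empty, zero_div]
    exact Real.log_natCast_nonneg _
  have hXn : Nonempty X := ⟨x₀⟩
  have hX : (0 : ℝ) < Fintype.card X := by exact_mod_cast Fintype.card_pos
  have hAn : Nonempty A := ⟨g x₀⟩
  have hA : (0 : ℝ) < Fintype.card A := by exact_mod_cast Fintype.card_pos
  have hinv : ∑ x, (1 : ℝ) / fiberCard g x ≤ Fintype.card A := by
    rw [← Finset.sum_fiberwise (s := Finset.univ) (g := g)]
    calc _ ≤ ∑ _a : A, (1 : ℝ) := Finset.sum_le_sum fun a _ => sum_inv_fiberCard_le_one g a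
      _ = _ := by simp
  have hterm : ∀ x, Real.log (Fintype.card X / fiberCard g x) ≤
      Real.log (Fintype.card A) + (Fintype.card X / Fintype.card A * (1 / fiberCard g x) - 1) := by
    intro x
    have hN : (0 : ℝ) < fiberCard g x := by exact_mod_cast fiberCard_pos g x
    have h1 : (Fintype.card X / fiberCard g x : ℝ)
        = Fintype.card A * (Fintype.card X / Fintype.card A * (1 / fiberCard g x)) := by
      field_simp
    rw [h1, Real.log_mul hA.ne' (by positivity)]
    gcongr
    exact Real.log_le_sub_one_of_pos (by positivity)
  unfold H
  rw [div_le_iff₀ hX]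
  refine (Finset.sum_le_sum fun x _ => hterm x).trans ?_
  rw [Finset.sum_add_distrib, Finset.sum_sub_distrib, ← Finset.mul_sum]
  simp only [Finset.sum_const, Finset.card_univ, nsmul_eq_mul, mul_one]
  have : (Fintype.card X / Fintype.card A : ℝ) * ∑ x, (1 : ℝ) / fiberCard g x ≤
      Fintype.card X / Fintype.card A * Fintype.card A := by gcongr
  rw [div_mul_cancel₀ _ hA.ne'] at this
  linarith

theorem H_of_injective [Nonempty X] {g : X → A} (hg : Function.Injective g) :
    H g = Real.log (Fintype.card X) := by
  have h1 : ∀ x, fiberCard g x = 1 := by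
    intro x
    unfold fiberCard
    rw [Finset.card_eq_one]
    exact ⟨x, by ext y; simp [hg.eq_iff]⟩
  have hX : (Fintype.card X : ℝ) ≠ 0 := by exact_mod_cast Fintype.card_ne_zero
  simp [H, h1, hX]

open Classical in
/-- The estimate behind submodularity: counting pairs `(y, z)` with `y` in the fibre of `(g, c)` and
`z` in the fibre of `(h, c)` through a common point. -/
theorem sum_ratio_le (g : X → A) (h : X → B) (c : X → C) :
    ∑ x, (fiberCard (fun x => (g x, c x)) x * fiberCard (fun x => (h x, c x)) x : ℝ) /
      (fiberCard (fun x => ((g x, h x), c x)) x * fiberCard c x) ≤ Fintype.card X := by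
  set N := fiberCard fun x => ((g x, h x), c x) with hN
  -- expand the numerator as a sum over pairs `(y, z)` and sum over `x` first
  have h1 : ∀ x, (fiberCard (fun x => (g x, c x)) x * fiberCard (fun x => (h x, c x)) x : ℝ) /
      (N x * fiberCard c x) = ∑ y, ∑ z, if ((g y, c y) = (g x, c x)) ∧ ((h z, c z) = (h x, c x))
        then (1 : ℝ) / (N x * fiberCard c x) else 0 := by
    intro x
    rw [show (fiberCard (fun x => (g x, c x)) x : ℝ) =
        ∑ y, if (g y, c y) = (g x, c x) then 1 else 0 by
          rw [fiberCard_eq_card, Finset.natCast_card_filter],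
      show (fiberCard (fun x => (h x, c x)) x : ℝ) =
        ∑ y, if (h y, c y) = (h x, c x) then 1 else 0 by
          rw [fiberCard_eq_card, Finset.natCast_card_filter],
      Finset.sum_mul_sum, Finset.sum_div]
    refine Finset.sum_congr rfl fun y _ => ?_
    rw [Finset.sum_div]
    refine Finset.sum_congr rfl fun z _ => ?_
    by_cases hy : (g y, c y) = (g x, c x) <;> by_cases hz : (h z, c z) = (h x, c x) <;>
      simp only [hy, hz, and_true, and_false, if_true, if_false] <;> simp
  have h2 : ∀ y z, (∑ x, if ((g y, c y) = (g x, c x)) ∧ ((h z, c z) = (h x, c x))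
        then (1 : ℝ) / (N x * fiberCard c x) else 0) ≤
        if c z = c y then (1 : ℝ) / fiberCard c y else 0 := by
    intro y z
    split_ifs with hc
    · rw [← Finset.sum_filter]
      calc _ = ∑ x with ((g x, h x), c x) = ((g y, h z), c y),
            (1 : ℝ) / N x * (1 / fiberCard c y) := by
            refine Finset.sum_congr ?_ ?_
            · ext x
              simp only [Finset.mem_filter, Finset.mem_univ, true_and, Prod.mk.injEq]
              constructor
              · rintro ⟨⟨a, b⟩, d, e⟩; exact ⟨⟨a.symm, d.symm⟩, b.symm⟩
              · rintro ⟨⟨a, b⟩, d⟩; exact ⟨⟨a.symm, d.symm⟩, b.symm, hc.trans d.symm⟩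
            · intro x hx
              simp only [Finset.mem_filter, Finset.mem_univ, true_and, Prod.mk.injEq] at hx
              rw [fiberCard_congr c hx.2, one_div_mul_one_div]
        _ ≤ 1 * (1 / fiberCard c y) := by
            rw [← Finset.sum_mul]
            gcongr
            exact sum_inv_fiberCard_le_one (fun x => ((g x, h x), c x)) ((g y, h z), c y)
        _ = _ := one_mul _
    · refine (Finset.sum_eq_zero fun x _ => if_neg ?_).le
      simp only [Prod.mk.injEq]
      rintro ⟨⟨_, a⟩, _, b⟩
      exact hc (b.trans a.symm)
  calc _ = ∑ y, ∑ z, ∑ x, if ((g y, c y) = (g x, c x)) ∧ ((h z, c z) = (h x, c x))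
        then (1 : ℝ) / (N x * fiberCard c x) else 0 := by
        rw [Finset.sum_congr rfl fun x _ => h1 x, Finset.sum_comm]
        exact Finset.sum_congr rfl fun y _ => Finset.sum_comm
    _ ≤ ∑ y, ∑ z, if c z = c y then (1 : ℝ) / fiberCard c y else 0 :=
        Finset.sum_le_sum fun y _ => Finset.sum_le_sum fun z _ => h2 y z
    _ = ∑ _y : X, (1 : ℝ) := by
        refine Finset.sum_congr rfl fun y _ => ?_
        rw [← Finset.sum_filter, Finset.sum_const, nsmul_eq_mul]
        have : (fiberCard c y : ℝ) ≠ 0 := by exact_mod_cast (fiberCard_pos c y).ne'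
        exact mul_one_div_cancel this
    _ = _ := by simp

/-- Strong subadditivity of entropy. -/
theorem H_submodular (g : X → A) (h : X → B) (c : X → C) :
    H (fun x => ((g x, h x), c x)) + H c ≤ H (fun x => (g x, c x)) + H (fun x => (h x, c x)) := by
  rcases isEmpty_or_nonempty X with hX | hXn
  · simp [H]
  have hX : (0 : ℝ) < Fintype.card X := by exact_mod_cast Fintype.card_pos
  unfold H
  rw [← add_div, ← add_div]
  gcongr ?_ / _
  rw [← Finset.sum_add_distrib, ← Finset.sum_add_distrib, ← sub_nonneg, ← Finset.sum_sub_distrib]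
  have h1 : ∀ x, 1 - (fiberCard (fun x => (g x, c x)) x * fiberCard (fun x => (h x, c x)) x : ℝ) /
      (fiberCard (fun x => ((g x, h x), c x)) x * fiberCard c x) ≤
      Real.log (Fintype.card X / fiberCard (fun x => (g x, c x)) x) +
      Real.log (Fintype.card X / fiberCard (fun x => (h x, c x)) x) -
      (Real.log (Fintype.card X / fiberCard (fun x => ((g x, h x), c x)) x) +
      Real.log (Fintype.card X / fiberCard c x)) := by
    intro x
    have e1 : (0 : ℝ) < fiberCard (fun x => (g x, c x)) x := by exact_mod_cast fiberCard_pos _ x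
    have e2 : (0 : ℝ) < fiberCard (fun x => (h x, c x)) x := by exact_mod_cast fiberCard_pos _ x
    have e3 : (0 : ℝ) < fiberCard (fun x => ((g x, h x), c x)) x := by
      exact_mod_cast fiberCard_pos _ x
    have e4 : (0 : ℝ) < fiberCard c x := by exact_mod_cast fiberCard_pos _ x
    have := Real.log_le_sub_one_of_pos (div_pos (mul_pos e1 e2) (mul_pos e3 e4))
    rw [Real.log_div (by positivity) (by positivity), Real.log_mul e1.ne' e2.ne',
      Real.log_mul e3.ne' e4.ne'] at this
    rw [Real.log_div hX.ne' e1.ne', Real.log_div hX.ne' e2.ne', Real.log_div hX.ne' e3.ne',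
      Real.log_div hX.ne' e4.ne']
    linarith
  refine le_trans ?_ (Finset.sum_le_sum fun x _ => h1 x)
  rw [Finset.sum_sub_distrib]
  have := sum_ratio_le g h c
  simp only [Finset.sum_const, Finset.card_univ, nsmul_eq_mul, mul_one]
  linarith

theorem condH_mono {g : X → A} {g' : X → B} {c : X → C}
    (h : ∀ x y, c x = c y → g' x = g' y → g x = g y) : condH g c ≤ condH g' c := by
  unfold condH
  gcongr
  refine H_mono fun x y hxy => ?_
  simp only [Prod.mk.injEq] at hxy ⊢
  exact ⟨h x y hxy.2 hxy.1, hxy.2⟩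

/-- Conditioning on more can only decrease entropy. -/
theorem condH_anti {D : Type*} (g : X → A) {c : X → C} {c' : X → D}
    (h : ∀ x y, c' x = c' y → c x = c y) : condH g c' ≤ condH g c := by
  unfold condH
  have h1 := H_submodular g c' c
  have h2 : H (fun x => (c' x, c x)) = H c' :=
    H_congr fun x y => by
      simp only [Prod.mk.injEq]
      exact ⟨fun a => ⟨a, h x y a⟩, fun a => a.1⟩
  have h3 : H (fun x => ((g x, c' x), c x)) = H (fun x => (g x, c' x)) :=
    H_congr fun x y => by
      simp only [Prod.mk.injEq]
      exact ⟨fun a => ⟨a, h x y a.2⟩, fun a => a.1⟩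
  linarith

theorem H_const_unit : H (fun _ : X => ()) = 0 := by
  rcases isEmpty_or_nonempty X with hX | hXn
  · simp [H]
  have hX : (Fintype.card X : ℝ) ≠ 0 := by exact_mod_cast Fintype.card_ne_zero
  simp [H, fiberCard, hX]

theorem condH_le_H (g : X → A) (c : X → C) : condH g c ≤ H g := by
  refine (condH_anti g (c := fun _ => ()) fun _ _ _ => rfl).trans ?_
  unfold condH
  rw [H_const_unit, sub_zero]
  exact H_mono fun x y h => by simpa using h

theorem condH_nonneg (g : X → A) (c : X → C) : 0 ≤ condH g c := by
  unfold condH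
  rw [sub_nonneg]
  exact H_mono fun x y h => (Prod.mk.inj h).2

/-- The restriction to `T` of a family of functions, as a single function. -/
def tuple {ι : Type*} {B : ι → Type*} (T : Finset ι) (a : (i : ι) → X → B i) (x : X) :
    (i : {i // i ∈ T}) → B i :=
  fun i => a i x

omit [Fintype X] in
theorem tuple_eq_iff {ι : Type*} {B : ι → Type*} (T : Finset ι) (a : (i : ι) → X → B i) (x y : X) :
    tuple T a x = tuple T a y ↔ ∀ i ∈ T, a i x = a i y := by
  simp [tuple, funext_iff]

theorem condH_tuple_le {ι : Type*} {B : ι → Type*} (T : Finset ι) (a : (i : ι) → X → B i)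
    (c : X → C) : condH (tuple T a) c ≤ ∑ i ∈ T, condH (a i) c := by
  classical
  induction T using Finset.induction_on with
  | empty =>
    simp only [Finset.sum_empty, condH, sub_nonpos]
    exact H_mono fun x y h => Prod.ext (by simp [tuple_eq_iff]) h
  | insert i T hi ih =>
    rw [Finset.sum_insert hi]
    have h1 := H_submodular (a i) (tuple T a) c
    have h2 : H (fun x => (tuple (insert i T) a x, c x)) =
        H (fun x => ((a i x, tuple T a x), c x)) :=
      H_congr fun x y => by simp [tuple_eq_iff]
    unfold condH at ih ⊢
    linarith

/-- If the `W i` are conditionally independent given `c`, in the sense that the joint conditional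
entropy is at least the sum of the individual ones, then so are functions `a i` of them: what `a`
loses jointly is at most the sum of the individual losses. -/
theorem sum_condH_le_condH_tuple {ι : Type*} {B D : ι → Type*} (T : Finset ι)
    (a : (i : ι) → X → B i) (W : (i : ι) → X → D i) (c : X → C)
    (haW : ∀ i x y, W i x = W i y → a i x = a i y)
    (hW : ∑ i ∈ T, condH (W i) c ≤ condH (tuple T W) c) :
    ∑ i ∈ T, condH (a i) c ≤ condH (tuple T a) c := by
  have h1 := condH_tuple_le T W (fun x => (tuple T a x, c x))
  have h2 : ∀ i ∈ T, condH (W i) (fun x => (tuple T a x, c x)) ≤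
      condH (W i) c - condH (a i) c := by
    intro i hi
    refine (condH_anti (W i) (c := fun x => (a i x, c x)) fun x y h => ?_).trans ?_
    · simp only [Prod.mk.injEq, tuple_eq_iff] at h ⊢
      exact ⟨h.1 i hi, h.2⟩
    · have : H (fun x => (W i x, (a i x, c x))) = H (fun x => (W i x, c x)) :=
        H_congr fun x y => by
          simp only [Prod.mk.injEq]
          exact ⟨fun h => ⟨h.1, haW i x y h.1, h.2⟩, fun h => ⟨h.1, h.2.2⟩⟩
      unfold condH
      linarith
  have h3 := h1.trans (Finset.sum_le_sum h2)
  rw [Finset.sum_sub_distrib] at h3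
  have h4 : H (fun x => (tuple T W x, (tuple T a x, c x))) = H (fun x => (tuple T W x, c x)) :=
    H_congr fun x y => by
      simp only [Prod.mk.injEq, tuple_eq_iff]
      exact ⟨fun h => ⟨h.1, fun i hi => haW i x y (h.1 i hi), h.2⟩, fun h => ⟨h.1, h.2.2⟩⟩
  unfold condH at *
  linarith

end UniformEntropy

/-! ### Decoding an MDS code over an extension field -/

/-- Any `k` columns of the generator matrix of an `(n, k)` MDS code form a matrix with nonzero
determinant; this persists over an extension field, so that a codeword over the extension that
vanishes on `k` nodes is zero. -/
theorem IsMDS.eq_zero_of_forall_mem {F : Type u} {K : Type v} [Field F] [DecidableEq F] [Field K]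
    [Algebra F K] {n k : ℕ} {G : Matrix (Fin k) (Fin n) F} (hG : IsMDS G) {T : Finset (Fin n)}
    (hT : k ≤ #T) {z : Fin k → K} (hz : ∀ l ∈ T, ∑ b, algebraMap F K (G b l) * z b = 0) :
    z = 0 := by
  obtain ⟨T', hT'T, hT'⟩ := Finset.exists_subset_card_eq hT
  let e := T'.equivFinOfCardEq hT'
  let M : Matrix (Fin k) (Fin k) F := G.submatrix id fun i => (e.symm i).1
  have hM : M.det ≠ 0 := by
    intro h0
    obtain ⟨x, hx0, hx⟩ := Matrix.exists_vecMul_eq_zero_iff.2 h0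
    have h1 := hG.2 ⟨x, hx0, rfl⟩
    have h2 : hammingNorm (x ᵥ* G) ≤ #T'ᶜ := by
      refine Finset.card_le_card fun l hl => ?_
      rw [Finset.mem_compl]
      intro hlT
      refine (Finset.mem_filter.1 hl).2 ?_
      have := congrFun hx (e ⟨l, hlT⟩)
      simpa [M, Matrix.vecMul, dotProduct] using this
    rw [Finset.card_compl, hT', Fintype.card_fin] at h2
    omega
  have hMK : (M.map (algebraMap F K)).det ≠ 0 := by
    rw [← RingHom.mapMatrix_apply, ← RingHom.map_det]
    simpa using hM
  refine Matrix.eq_zero_of_vecMul_eq_zero hMK ?_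
  ext i
  have := hz _ (hT'T (e.symm i).2)
  simpa [M, Matrix.vecMul, dotProduct, mul_comm] using this

/-! ### Perfect privacy means that the law of every query is independent of the file -/

theorem negMulLog_le_of_nonneg {x N : ℝ} (hx : 0 ≤ x) (hN : 0 < N) :
    Real.negMulLog x ≤ x * Real.log N + (1 / N - x) := by
  rcases hx.eq_or_lt with rfl | hx
  · simp [Real.negMulLog, hN.le]
  · have h := Real.log_le_sub_one_of_pos (x := 1 / (x * N)) (by positivity)
    rw [one_div, Real.log_inv, Real.log_mul hx.ne' hN.ne'] at h
    have h2 := mul_le_mul_of_nonneg_left h hx.le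
    have h3 : x * ((x * N)⁻¹ - 1) = 1 / N - x := by field_simp
    unfold Real.negMulLog
    linarith

theorem negMulLog_lt_of_ne {x N : ℝ} (hx : 0 ≤ x) (hN : 0 < N) (hxN : x ≠ 1 / N) :
    Real.negMulLog x < x * Real.log N + (1 / N - x) := by
  rcases hx.eq_or_lt with rfl | hx
  · simp [Real.negMulLog, hN]
  · have h := Real.log_lt_sub_one_of_pos (x := 1 / (x * N)) (by positivity) (by
      intro h; apply hxN; field_simp at h ⊢; exact h.symm)
    rw [one_div, Real.log_inv, Real.log_mul hx.ne' hN.ne'] at h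
    have h2 := mul_lt_mul_of_pos_left h hx
    have h3 : x * ((x * N)⁻¹ - 1) = 1 / N - x := by field_simp
    unfold Real.negMulLog
    linarith

theorem sum_maxEntropy_terms {A : Type*} [Fintype A] [Nonempty A] {p : A → ℝ}
    (hp : ∑ a, p a = 1) :
    ∑ a, (p a * Real.log (Fintype.card A) + (1 / (Fintype.card A : ℝ) - p a)) =
      Real.log (Fintype.card A) := by
  have : (Fintype.card A : ℝ) ≠ 0 := by exact_mod_cast Fintype.card_ne_zero
  rw [Finset.sum_add_distrib, Finset.sum_sub_distrib, ← Finset.sum_mul, hp]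
  simp [this]

theorem entropy_le_log_card {A : Type*} [Fintype A] [Nonempty A] {p : A → ℝ}
    (hp0 : ∀ a, 0 ≤ p a) (hp : ∑ a, p a = 1) : entropy p ≤ Real.log (Fintype.card A) := by
  rw [← sum_maxEntropy_terms hp]
  exact Finset.sum_le_sum fun a _ =>
    negMulLog_le_of_nonneg (hp0 a) (by exact_mod_cast Fintype.card_pos)

theorem entropy_uniform (A : Type*) [Fintype A] [Nonempty A] :
    entropy (fun _ : A => 1 / (Fintype.card A : ℝ)) = Real.log (Fintype.card A) := by
  have : (Fintype.card A : ℝ) ≠ 0 := by exact_mod_cast Fintype.card_ne_zero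
  simp [entropy, Real.negMulLog, this]

theorem eq_uniform_of_entropy_eq {A : Type*} [Fintype A] [Nonempty A] {p : A → ℝ}
    (hp0 : ∀ a, 0 ≤ p a) (hp : ∑ a, p a = 1) (h : entropy p = Real.log (Fintype.card A)) (a : A) :
    p a = 1 / Fintype.card A := by
  by_contra hne
  have hN : (0 : ℝ) < Fintype.card A := by exact_mod_cast Fintype.card_pos
  have : entropy p < Real.log (Fintype.card A) := by
    rw [← sum_maxEntropy_terms hp]
    exact Finset.sum_lt_sum (fun a _ => negMulLog_le_of_nonneg (hp0 a) hN)
      ⟨a, Finset.mem_univ _, negMulLog_lt_of_ne (hp0 a) hN hne⟩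
  exact this.ne h

/-- `H(A | B) = log |A|` exactly when `A` is conditionally uniform. -/
theorem condEntropy_eq_log_card_iff {A B : Type*} [Fintype A] [Fintype B] [Nonempty A]
    {p : A → B → ℝ} (hp0 : ∀ a b, 0 ≤ p a b) (hp : ∑ b, ∑ a, p a b = 1) :
    condEntropy p = entropy (fun _ : A => 1 / (Fintype.card A : ℝ)) ↔
      ∀ a a' b, p a b = p a' b := by
  rw [entropy_uniform]
  have hP0 : ∀ b, 0 ≤ ∑ a, p a b := fun b => Finset.sum_nonneg fun a _ => hp0 a b
  have hN : (Fintype.card A : ℝ) ≠ 0 := by exact_mod_cast Fintype.card_ne_zero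
  constructor
  · intro h a a' b
    rcases (hP0 b).eq_or_lt with hb | hb
    · have := (Finset.sum_eq_zero_iff_of_nonneg fun a _ => hp0 a b).1 hb.symm
      rw [this a (Finset.mem_univ _), this a' (Finset.mem_univ _)]
    have hnn : ∀ b ∈ Finset.univ, 0 ≤ (∑ a, p a b) *
        (Real.log (Fintype.card A) - entropy fun a => p a b / ∑ a', p a' b) := by
      intro b _
      rcases (hP0 b).eq_or_lt with hb | hb
      · rw [← hb, zero_mul]
      · refine mul_nonneg hb.le (sub_nonneg.2 (entropy_le_log_card ?_ ?_))
        · exact fun a => div_nonneg (hp0 a b) hb.le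
        · rw [← Finset.sum_div, div_self hb.ne']
    have hsum : ∑ b, (∑ a, p a b) *
        (Real.log (Fintype.card A) - entropy fun a => p a b / ∑ a', p a' b) = 0 := by
      simp_rw [mul_sub]
      rw [Finset.sum_sub_distrib, ← Finset.sum_mul, hp, one_mul, ← h]
      exact sub_self _
    have hz := (Finset.sum_eq_zero_iff_of_nonneg hnn).1 hsum b (Finset.mem_univ _)
    have he := (mul_eq_zero.1 hz).resolve_left hb.ne'
    have hu := eq_uniform_of_entropy_eq (p := fun a => p a b / ∑ a', p a' b)
      (fun a => div_nonneg (hp0 a b) hb.le) (by rw [← Finset.sum_div, div_self hb.ne'])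
      (sub_eq_zero.1 he).symm
    have := (hu a).trans (hu a').symm
    exact (div_left_inj' hb.ne').1 this
  · intro h
    have : ∀ b, (∑ a, p a b) * entropy (fun a => p a b / ∑ a', p a' b) =
        (∑ a, p a b) * Real.log (Fintype.card A) := by
      intro b
      rcases (hP0 b).eq_or_lt with hb | hb
      · rw [← hb, zero_mul, zero_mul]
      · congr 1
        rw [← entropy_uniform A]
        congr 1
        ext a
        have : ∑ a', p a' b = Fintype.card A * p a b := by
          rw [Finset.sum_congr rfl fun a' _ => h a' a b]; simp
        rw [this] at hb ⊢
        have h0 : p a b ≠ 0 := fun h0 => by simp [h0] at hb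
        field_simp
    unfold condEntropy
    rw [Finset.sum_congr rfl fun b _ => this b, ← Finset.sum_mul, hp, one_mul]

namespace PIRScheme

variable {K : Type v} {n m α : ℕ} (P : PIRScheme.{v, w} K n m α)

theorem joint_nonneg (l : Fin n) (f : Fin m) (q : P.Query l) : 0 ≤ P.joint l f q := by
  classical
  refine Finset.sum_nonneg fun ω _ => ?_
  split_ifs
  · exact div_nonneg (P.prob_nonneg ω) (Nat.cast_nonneg m)
  · exact le_rfl

/-- The expectation of a function of the query to node `l`, given the requested index. -/
theorem sum_prob_mul_query (hm : 0 < m) (l : Fin n) (f : Fin m) (φ : P.Query l → ℝ) :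
    ∑ ω, P.prob ω * φ (P.query f ω l) = ∑ q, m * P.joint l f q * φ q := by
  classical
  have hm' : (m : ℝ) ≠ 0 := by exact_mod_cast hm.ne'
  have : ∀ q, m * P.joint l f q * φ q =
      ∑ ω, if P.query f ω l = q then P.prob ω * φ q else 0 := by
    intro q
    unfold joint
    rw [Finset.mul_sum, Finset.sum_mul]
    refine Finset.sum_congr rfl fun ω _ => ?_
    by_cases h : P.query f ω l = q
    · simp only [h, if_true]; field_simp
    · simp [h]
  simp_rw [this]
  rw [Finset.sum_comm]
  simp

theorem sum_joint (hm : 0 < m) (l : Fin n) : ∑ q, ∑ f, P.joint l f q = 1 := by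
  have hm' : (m : ℝ) ≠ 0 := by exact_mod_cast hm.ne'
  rw [Finset.sum_comm]
  have h : ∀ f, ∑ q, P.joint l f q = 1 / m := by
    intro f
    have := P.sum_prob_mul_query hm l f fun _ => 1
    simp only [mul_one, P.prob_sum] at this
    rw [← Finset.mul_sum] at this
    field_simp
    linarith
  simp [h, hm']

theorem isPrivate_iff (hm : 0 < m) :
    P.IsPrivate ↔ ∀ l f f' q, P.joint l f q = P.joint l f' q := by
  have : Nonempty (Fin m) := ⟨⟨0, hm⟩⟩
  unfold IsPrivate
  refine forall_congr' fun l => ?_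
  have := condEntropy_eq_log_card_iff (P.joint_nonneg l) (P.sum_joint hm l)
  rwa [Fintype.card_fin] at this

variable {P} in
theorem IsPrivate.sum_prob_mul_query_eq (hP : P.IsPrivate) (l : Fin n) (f f' : Fin m)
    (φ : P.Query l → ℝ) :
    ∑ ω, P.prob ω * φ (P.query f ω l) = ∑ ω, P.prob ω * φ (P.query f' ω l) := by
  have hm : 0 < m := f.pos
  rw [P.sum_prob_mul_query hm, P.sum_prob_mul_query hm]
  simp_rw [(P.isPrivate_iff hm).1 hP l f f']

end PIRScheme

/-! ### The converse bound on the price of privacy -/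

/-- The `k` largest values of `h` on `R` have at least the average of all the values. -/
theorem exists_subset_card_eq_mul_sum_le {ι : Type*} [DecidableEq ι] (h : ι → ℝ) {k : ℕ}
    {R : Finset ι} (hkR : k ≤ #R) :
    ∃ T ⊆ R, #T = k ∧ k * ∑ i ∈ R, h i ≤ #R * ∑ i ∈ T, h i := by
  induction hd : #R - k generalizing R with
  | zero =>
    have hk : k = #R := by omega
    exact ⟨R, Finset.Subset.refl R, hk.symm, by rw [hk]⟩
  | succ d ih =>
    obtain ⟨i₀, hi₀, hmin⟩ := Finset.exists_min_image R h (Finset.card_pos.1 (by omega))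
    have hcard := Finset.card_erase_of_mem hi₀
    obtain ⟨T, hTR, hT, hle⟩ := ih (R := R.erase i₀) (by omega) (by omega)
    refine ⟨T, hTR.trans (Finset.erase_subset _ _), hT, ?_⟩
    rw [← Finset.add_sum_erase R h hi₀]
    rw [hcard, Nat.cast_sub (by omega), Nat.cast_one] at hle
    -- the values on `T` are at least the discarded minimum
    have h1 : k * h i₀ ≤ ∑ i ∈ T, h i := by
      have := Finset.card_nsmul_le_sum T h (h i₀) fun i hi =>
        hmin i (Finset.mem_of_mem_erase (hTR hi))
      rwa [hT, nsmul_eq_mul] at this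
    linarith

namespace PIRScheme

open UniformEntropy

section Files

variable {F : Type u} {K : Type v} [Field F] [Field K] [Fintype K] [Algebra F K] {n m α k : ℕ}

/-- The files with index less than `j`. -/
def filesBelow (j : ℕ) (X : Files K m α k) : {f : Fin m // f.val < j} → Fin α → Fin k → K :=
  fun f => X f

/-- The files with index at least `j`. -/
def filesFrom (j : ℕ) (X : Files K m α k) : {f : Fin m // ¬ f.val < j} → Fin α → Fin k → K :=
  fun f => X f

omit [Field K] [Fintype K] in
theorem filesBelow_eq_iff {j : ℕ} {X Y : Files K m α k} :
    filesBelow j X = filesBelow j Y ↔ ∀ f : Fin m, f.val < j → X f = Y f :=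
  ⟨fun h f hf => congrFun h ⟨f, hf⟩, fun h => funext fun f => h f f.2⟩

theorem card_fin_lt {j : ℕ} (hj : j ≤ m) : Fintype.card {f : Fin m // f.val < j} = j := by
  simpa using (Fintype.card_congr (Fin.castLEquiv hj)).symm

theorem card_fin_not_lt {j : ℕ} (hj : j ≤ m) : Fintype.card {f : Fin m // ¬ f.val < j} = m - j := by
  rw [Fintype.card_subtype_compl, card_fin_lt hj, Fintype.card_fin]

theorem H_filesBelow {j : ℕ} (hj : j ≤ m) :
    H (filesBelow j : Files K m α k → _) = j * (k * α * Real.log (Fintype.card K)) := by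
  classical
  have h1 : H (filesBelow j : Files K m α k → _) ≤ j * (k * α * Real.log (Fintype.card K)) := by
    refine (H_le_log_card _).trans (le_of_eq ?_)
    simp only [Fintype.card_fun, Fintype.card_fin, card_fin_lt hj, Nat.cast_pow, Real.log_pow]
    ring
  have h2 : H (filesFrom j : Files K m α k → _) ≤
      (m - j) * (k * α * Real.log (Fintype.card K)) := by
    refine (H_le_log_card _).trans (le_of_eq ?_)
    simp only [Fintype.card_fun, Fintype.card_fin, card_fin_not_lt hj, Nat.cast_pow, Real.log_pow,
      Nat.cast_sub hj]
    ring
  have h3 := H_of_injective (X := Files K m α k) (g := fun X => X) fun _ _ h => h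
  have h4 : H (fun X : Files K m α k => X) ≤
      H (fun X : Files K m α k => (filesFrom j X, filesBelow j X)) := H_mono fun X Y h => by
    simp only [Prod.mk.injEq] at h
    ext f : 1
    by_cases hf : f.val < j
    · exact congrFun h.2 ⟨f, hf⟩
    · exact congrFun h.1 ⟨f, hf⟩
  have h5 := condH_le_H (filesFrom j : Files K m α k → _) (filesBelow j)
  have h6 : Real.log (Fintype.card (Files K m α k)) =
      m * (k * α * Real.log (Fintype.card K)) := by
    simp only [Fintype.card_fun, Fintype.card_fin, Nat.cast_pow, Real.log_pow]
    ring
  unfold condH at h5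
  linarith

/-- The vectors stored on `k` nodes of an MDS code are independent given the first `j` files. -/
theorem sum_condH_stored_le [DecidableEq F] {G : Matrix (Fin k) (Fin n) F} (hG : IsMDS G) {j : ℕ}
    (hj : j ≤ m) {T : Finset (Fin n)} (hT : #T = k) :
    ∑ l ∈ T, condH (fun X : Files K m α k => stored G X l) (filesBelow j) ≤
      condH (tuple T fun l (X : Files K m α k) => stored G X l) (filesBelow j) := by
  classical
  have h1 : ∀ l, condH (fun X : Files K m α k => stored G X l) (filesBelow j) ≤
      (m - j) * (α * Real.log (Fintype.card K)) := by
    intro l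
    -- given the first `j` files, only the part of the vector for the other files matters
    let W : Files K m α k → {f : Fin m // ¬ f.val < j} → Fin α → K :=
      fun X f a => stored G X l (f, a)
    have hW : condH (fun X : Files K m α k => stored G X l) (filesBelow j) ≤
        condH W (filesBelow j) := by
      refine condH_mono fun X Y hXY hW => ?_
      rw [filesBelow_eq_iff] at hXY
      ext ⟨f, a⟩
      by_cases hf : f.val < j
      · simp only [stored, hXY f hf]
      · exact congrFun (congrFun hW ⟨f, hf⟩) a
    refine (hW.trans (condH_le_H _ _)).trans ((H_le_log_card W).trans (le_of_eq ?_))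
    simp only [Fintype.card_fun, Fintype.card_fin, card_fin_not_lt hj, Nat.cast_pow, Real.log_pow,
      Nat.cast_sub hj]
  have h2 : H (fun X : Files K m α k => X) ≤ H (fun X : Files K m α k =>
      (tuple T (fun l (X : Files K m α k) => stored G X l) X, filesBelow j X)) := by
    refine H_mono fun X Y h => ?_
    rw [Prod.mk.injEq, tuple_eq_iff] at h
    funext f a
    rw [← sub_eq_zero]
    refine hG.eq_zero_of_forall_mem hT.ge fun l hl => ?_
    have := congrFun (h.1 l hl) (f, a)
    simp only [stored] at this
    simp only [Pi.sub_apply, mul_sub, Finset.sum_sub_distrib, this, sub_self]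
  rw [H_of_injective fun _ _ h => h] at h2
  have h3 : Real.log (Fintype.card (Files K m α k)) =
      m * (k * α * Real.log (Fintype.card K)) := by
    simp only [Fintype.card_fun, Fintype.card_fin, Nat.cast_pow, Real.log_pow]
    ring
  have h4 := Finset.sum_le_sum fun l (_ : l ∈ T) => h1 l
  rw [Finset.sum_const, hT, nsmul_eq_mul] at h4
  refine h4.trans ?_
  unfold condH
  rw [H_filesBelow hj]
  linarith

variable (P : PIRScheme.{v, w} K n m α)

/-- The answer of node `l` to the query `q`, as a function of the files. -/
def reply (G : Matrix (Fin k) (Fin n) F) (l : Fin n) (q : P.Query l) (X : Files K m α k) :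
    Fin (P.len l q) → K :=
  P.answer l q (stored G X l)

/-- The entropy of the answer of node `l` to `q`, given the first `j` files. -/
noncomputable def replyEntropy (G : Matrix (Fin k) (Fin n) F) (j : ℕ) (l : Fin n)
    (q : P.Query l) : ℝ :=
  condH (P.reply G l q) (filesBelow j)

/-- All the answers of the nodes in `R` when file `f` is requested with randomness `ω`. -/
def replies (G : Matrix (Fin k) (Fin n) F) (R : Finset (Fin n)) (f : Fin m) (ω : P.Ω) :
    Files K m α k → (l : {l // l ∈ R}) → Fin (P.len l (P.query f ω l)) → K :=
  tuple R fun l => P.reply G l (P.query f ω l)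

theorem condH_replies_le (G : Matrix (Fin k) (Fin n) F) (R : Finset (Fin n)) (f : Fin m) (ω : P.Ω)
    (j : ℕ) : condH (P.replies G R f ω) (filesBelow j) ≤
      ∑ l ∈ R, P.replyEntropy G j l (P.query f ω l) :=
  condH_tuple_le R (fun l => P.reply G l (P.query f ω l)) (filesBelow j)

/-- Answers of `k` nodes are independent given the first files, so that the joint entropy of all
answers is at least a fraction `k / |R|` of the sum of the individual entropies. -/
theorem le_condH_replies [DecidableEq F] {G : Matrix (Fin k) (Fin n) F} (hG : IsMDS G)
    {R : Finset (Fin n)} (hR : k ≤ #R) (f : Fin m) (ω : P.Ω) {j : ℕ} (hj : j ≤ m) :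
    k * ∑ l ∈ R, P.replyEntropy G j l (P.query f ω l) ≤
      #R * condH (P.replies G R f ω) (filesBelow j) := by
  obtain ⟨T, hTR, hT, hle⟩ := exists_subset_card_eq_mul_sum_le
    (fun l => P.replyEntropy G j l (P.query f ω l)) hR
  refine hle.trans ?_
  gcongr
  refine (sum_condH_le_condH_tuple T (fun l => P.reply G l (P.query f ω l))
    (fun l X => stored G X l) (filesBelow j) (fun l X Y h => ?_)
    (sum_condH_stored_le hG hj hT)).trans ?_
  · simp only [reply, h]
  · refine condH_mono fun X Y _ h => ?_
    rw [replies, tuple_eq_iff] at h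
    rw [tuple_eq_iff]
    exact fun l hl => h l (hTR hl)

variable {P} in
/-- The answers determine the requested file, which contributes its entropy. -/
theorem Retrieves.add_condH_replies_le {G : Matrix (Fin k) (Fin n) F} {R : Finset (Fin n)}
    (hP : P.Retrieves G R) (f : Fin m) {ω : P.Ω} (hω : P.prob ω ≠ 0) :
    k * α * Real.log (Fintype.card K) + condH (P.replies G R f ω) (filesBelow (f.val + 1)) ≤
      condH (P.replies G R f ω) (filesBelow f.val) := by
  obtain ⟨dec, hdec⟩ := hP f ω hω
  have h1 : H (fun X => (P.replies G R f ω X, filesBelow (f.val + 1) X)) ≤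
      H (fun X => (P.replies G R f ω X, filesBelow f.val X)) := by
    refine H_mono fun X Y h => ?_
    simp only [Prod.mk.injEq, filesBelow_eq_iff] at h ⊢
    refine ⟨h.1, fun f' hf' => ?_⟩
    rcases Nat.lt_succ_iff_lt_or_eq.1 hf' with hlt | heq
    · exact h.2 f' hlt
    · rw [Fin.ext heq, ← hdec X, ← hdec Y]
      exact congrArg dec h.1
  unfold condH
  rw [H_filesBelow f.2, H_filesBelow f.2.le]
  push_cast
  linarith

theorem replyEntropy_le (G : Matrix (Fin k) (Fin n) F) (j : ℕ) (l : Fin n) (q : P.Query l) :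
    P.replyEntropy G j l q ≤ P.len l q * Real.log (Fintype.card K) := by
  classical
  refine ((condH_le_H _ _).trans (H_le_log_card _)).trans (le_of_eq ?_)
  simp only [Fintype.card_fun, Fintype.card_fin, Nat.cast_pow, Real.log_pow]

/-- The expected sum of the entropies of the individual answers of the nodes in `R`, given the
first `j` files, when file `f` is requested. -/
noncomputable def meanReplyEntropy (G : Matrix (Fin k) (Fin n) F) (R : Finset (Fin n)) (f : Fin m)
    (j : ℕ) : ℝ :=
  ∑ ω, P.prob ω * ∑ l ∈ R, P.replyEntropy G j l (P.query f ω l)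

variable {P} in
theorem IsPrivate.meanReplyEntropy_eq (hP : P.IsPrivate) (G : Matrix (Fin k) (Fin n) F)
    (R : Finset (Fin n)) (f f' : Fin m) (j : ℕ) :
    P.meanReplyEntropy G R f j = P.meanReplyEntropy G R f' j := by
  unfold meanReplyEntropy
  simp_rw [Finset.mul_sum]
  rw [Finset.sum_comm, Finset.sum_comm (s := Finset.univ) (t := R)]
  exact Finset.sum_congr rfl fun l _ => hP.sum_prob_mul_query_eq l f f' _

/-- The recursion of the converse: revealing the requested file `j` accounts for its entropy, and
by privacy the nodes answer a request for the next file with the same individual entropies. -/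
theorem meanReplyEntropy_step [DecidableEq F] {P : PIRScheme.{v, w} K n m α} (hP : P.IsPrivate)
    {G : Matrix (Fin k) (Fin n) F} (hG : IsMDS G) {R : Finset (Fin n)} (hR : k ≤ #R)
    (hR0 : 0 < #R) (hret : P.Retrieves G R) (f₀ f : Fin m) :
    k * α * Real.log (Fintype.card K) + k / #R * P.meanReplyEntropy G R f₀ (f.val + 1) ≤
      P.meanReplyEntropy G R f₀ f.val := by
  rw [hP.meanReplyEntropy_eq G R f₀ f, hP.meanReplyEntropy_eq G R f₀ f]
  have h1 : k * α * Real.log (Fintype.card K) =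
      ∑ ω, P.prob ω * (k * α * Real.log (Fintype.card K)) := by
    rw [← Finset.sum_mul, P.prob_sum, one_mul]
  rw [h1]
  unfold meanReplyEntropy
  rw [Finset.mul_sum, ← Finset.sum_add_distrib]
  refine Finset.sum_le_sum fun ω _ => ?_
  by_cases hω : P.prob ω = 0
  · simp [hω]
  have h2 := P.le_condH_replies hG hR f ω (j := f.val + 1) f.2
  have h3 := hret.add_condH_replies_le f hω
  have h4 := P.condH_replies_le G R f ω f.val
  have hR' : (0 : ℝ) < #R := by exact_mod_cast hR0
  rw [mul_left_comm ((k : ℝ) / #R), ← mul_add]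
  refine mul_le_mul_of_nonneg_left ?_ (P.prob_nonneg ω)
  have h5 : (k : ℝ) / #R * ∑ l ∈ R, P.replyEntropy G (f.val + 1) l (P.query f ω l) ≤
      condH (P.replies G R f ω) (filesBelow (f.val + 1)) := by
    rw [div_mul_eq_mul_div, div_le_iff₀ hR', mul_comm (condH _ _)]
    exact h2
  linarith

theorem geom_sum_le_meanReplyEntropy [DecidableEq F] {P : PIRScheme.{v, w} K n m α}
    (hP : P.IsPrivate) {G : Matrix (Fin k) (Fin n) F} (hG : IsMDS G) {R : Finset (Fin n)}
    (hR : k ≤ #R) (hR0 : 0 < #R) (hret : P.Retrieves G R) (f₀ : Fin m) (d : ℕ) (j : ℕ)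
    (hdj : d + j = m) :
    k * α * Real.log (Fintype.card K) * ∑ i ∈ range d, ((k : ℝ) / #R) ^ i ≤
      P.meanReplyEntropy G R f₀ j := by
  induction d generalizing j with
  | zero =>
    simp only [Finset.range_zero, Finset.sum_empty, mul_zero]
    exact Finset.sum_nonneg fun ω _ => mul_nonneg (P.prob_nonneg ω)
      (Finset.sum_nonneg fun l _ => condH_nonneg _ _)
  | succ d ih =>
    have h1 := meanReplyEntropy_step hP hG hR hR0 hret f₀ ⟨j, by omega⟩
    have h2 := ih (j + 1) (by omega)
    have h3 : (0 : ℝ) ≤ k / #R := by positivity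
    have h4 := mul_le_mul_of_nonneg_left h2 h3
    rw [Finset.sum_range_succ']
    simp only [pow_succ, ← Finset.sum_mul, pow_zero]
    refine le_trans (le_of_eq ?_) ((add_le_add_right h4 _).trans h1)
    ring

theorem geom_sum_le_cPoP [DecidableEq F] {P : PIRScheme.{v, w} K n m α}
    (hP : P.IsPrivate) {G : Matrix (Fin k) (Fin n) F} (hG : IsMDS G) {R : Finset (Fin n)}
    (hk : 0 < k) (hα : 0 < α) (hm : 0 < m) (hR : k ≤ #R) (hret : P.Retrieves G R) :
    ∑ i ∈ range m, ((k : ℝ) / #R) ^ i ≤ P.cPoP k R := by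
  let f₀ : Fin m := ⟨0, hm⟩
  have h1 := geom_sum_le_meanReplyEntropy hP hG hR (hk.trans_le hR) hret f₀ m 0 (by omega)
  have hlog : 0 < Real.log (Fintype.card K) :=
    Real.log_pos (by exact_mod_cast Fintype.one_lt_card)
  have hm' : (m : ℝ) ≠ 0 := by exact_mod_cast hm.ne'
  have h2 : P.meanReplyEntropy G R f₀ 0 ≤
      (∑ ω, P.prob ω * ∑ l ∈ R, (P.len l (P.query f₀ ω l) : ℝ)) * Real.log (Fintype.card K) := by
    unfold meanReplyEntropy
    rw [Finset.sum_mul]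
    refine Finset.sum_le_sum fun ω _ => ?_
    rw [mul_assoc, Finset.sum_mul]
    exact mul_le_mul_of_nonneg_left (Finset.sum_le_sum fun l _ => P.replyEntropy_le G 0 l _)
      (P.prob_nonneg ω)
  have h3 : ∑ ω, P.prob ω * ∑ l ∈ R, (P.len l (P.query f₀ ω l) : ℝ) =
      ∑ l ∈ R, ∑ f, ∑ ω, P.prob ω / m * P.len l (P.query f ω l) := by
    simp_rw [Finset.mul_sum]
    rw [Finset.sum_comm]
    refine Finset.sum_congr rfl fun l _ => ?_
    have : ∀ f, ∑ ω, P.prob ω / m * (P.len l (P.query f ω l) : ℝ) =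
        (∑ ω, P.prob ω * (P.len l (P.query f₀ ω l) : ℝ)) / m := by
      intro f
      rw [← hP.sum_prob_mul_query_eq l f f₀ fun q => (P.len l q : ℝ), Finset.sum_div]
      exact Finset.sum_congr rfl fun ω _ => by ring
    simp_rw [this]
    simp only [Finset.sum_const, Finset.card_univ, Fintype.card_fin, nsmul_eq_mul]
    field_simp
  unfold cPoP
  rw [← h3]
  have hα' : (0 : ℝ) < α := by exact_mod_cast hα
  have hk' : (0 : ℝ) < k := by exact_mod_cast hk
  rw [le_div_iff₀ (by positivity)]
  refine le_of_mul_le_mul_right ?_ hlog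
  refine le_trans (le_of_eq ?_) (h1.trans h2)
  ring

end Files

end PIRScheme

/-- For `k < |R|` the geometric series `∑ (k / |R|) ^ i` converges to `|R| / (|R| - k)`. -/
theorem isAsymptoticLowerBound_of_isMDS {F : Type u} {K : Type v} [Field F] [DecidableEq F]
    [Field K] [Fintype K] [Algebra F K] {n k : ℕ} (hk : 0 < k) {G : Matrix (Fin k) (Fin n) F}
    (hG : IsMDS G) {R : Finset (Fin n)} (hR : k < #R) :
    IsAsymptoticLowerBound.{u, v, w} K G R ((#R : ℝ) / (#R - k)) := by
  intro ε hε
  have hR' : (k : ℝ) < #R := by exact_mod_cast hR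
  have hR0 : (0 : ℝ) < #R := (Nat.cast_nonneg k).trans_lt hR'
  have hs := (hasSum_geometric_of_lt_one (r := (k : ℝ) / #R) (by positivity)
    ((div_lt_one hR0).2 hR')).tendsto_sum_nat
  have hlim : (1 - (k : ℝ) / #R)⁻¹ = (#R : ℝ) / (#R - k) := by
    have : (#R : ℝ) - k ≠ 0 := by linarith
    rw [one_sub_div hR0.ne', inv_div]
  rw [hlim] at hs
  obtain ⟨M, hM⟩ := Filter.eventually_atTop.1 (hs.eventually (lt_mem_nhds (sub_lt_self _ hε)))
  refine ⟨M + 1, fun m hm α hα P hP hret => ?_⟩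
  exact (hM m (by omega)).le.trans
    (PIRScheme.geom_sum_le_cPoP hP hG hk hα (by omega) hR.le hret)

namespace TwoLayer

/-! ### Sizes of the two layers -/

theorem baseDim_mul_gcd {n k : ℕ} (hkn : k < n) : baseDim n k * Nat.gcd k (n - k) = k := by
  have hpos : 0 < n - k := by omega
  have hlcm : Nat.lcm k (n - k) = baseDim n k * (n - k) :=
    (Nat.div_mul_cancel (Nat.dvd_lcm_right k (n - k))).symm
  have h := Nat.gcd_mul_lcm k (n - k)
  rw [hlcm] at h
  refine Nat.eq_of_mul_eq_mul_right hpos ?_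
  rw [← h]; ring

theorem subdiv_mul_gcd {n k : ℕ} (hk : 0 < k) : subdiv n k * Nat.gcd k (n - k) = n - k := by
  have hlcm : Nat.lcm k (n - k) = subdiv n k * k :=
    (Nat.div_mul_cancel (Nat.dvd_lcm_left k (n - k))).symm
  have h := Nat.gcd_mul_lcm k (n - k)
  rw [hlcm] at h
  refine Nat.eq_of_mul_eq_mul_left hk ?_
  rw [← h]; ring

theorem baseDim_mul_sub {n k : ℕ} (hk : 0 < k) (hkn : k < n) :
    baseDim n k * (n - k) = k * subdiv n k := by
  calc _ = baseDim n k * (subdiv n k * Nat.gcd k (n - k)) := by rw [subdiv_mul_gcd hk]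
    _ = baseDim n k * Nat.gcd k (n - k) * subdiv n k := by ring
    _ = _ := by rw [baseDim_mul_gcd hkn]

theorem subdiv_pos {n k : ℕ} (hk : 0 < k) (hkn : k < n) : 0 < subdiv n k := by
  rcases Nat.eq_zero_or_pos (subdiv n k) with h | h
  · have := subdiv_mul_gcd (n := n) hk
    rw [h] at this; omega
  · exact h

theorem alpha_pos {n k ν : ℕ} (hk : 0 < k) (hν : ν + k < n) : 0 < alpha n k ν := by
  refine Nat.pos_of_ne_zero fun h => ?_
  obtain ⟨i, hi, h0⟩ := Finset.lcm_eq_zero_iff.1 h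
  have hi' := Finset.mem_range.1 hi
  exact (subdiv_pos (n := n - i) hk (by omega)).ne' h0

theorem subdiv_dvd_alpha {n k ν i : ℕ} (hi : i ≤ ν) : subdiv (n - i) k ∣ alpha n k ν :=
  Finset.dvd_lcm (f := fun i => subdiv (n - i) k) (Finset.mem_range.2 (by omega))

theorem dim_mul_sub {n k ν i : ℕ} (hk : 0 < k) (hν : ν + k < n) (hi : i ≤ ν) :
    dim n k ν i * (n - i - k) = k * alpha n k ν := by
  have h := baseDim_mul_sub (n := n - i) hk (by omega)
  unfold dim
  rw [mul_right_comm, h, mul_assoc, Nat.mul_div_cancel' (subdiv_dvd_alpha hi)]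

theorem dim_zero_le {n k ν i : ℕ} (hk : 0 < k) (hν : ν + k < n) (hi : i ≤ ν) :
    dim n k ν 0 ≤ dim n k ν i := by
  have h0 := dim_mul_sub (i := 0) hk hν (Nat.zero_le _)
  have hi' := dim_mul_sub hk hν hi
  refine Nat.le_of_mul_le_mul_right (c := n - i - k) ?_ (by omega)
  rw [hi', ← h0]
  exact Nat.mul_le_mul_left _ (by omega)

/-- The missing parts exactly fill the new subqueries. -/
theorem dim_sub_mul {n k ν i : ℕ} (hk : 0 < k) (hν : ν + k < n) (hi : i ≤ ν) :
    (dim n k ν i - dim n k ν 0) * (n - i - k) = dim n k ν 0 * i := by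
  have h0 := dim_mul_sub (i := 0) hk hν (Nat.zero_le _)
  rw [Nat.sub_mul, dim_mul_sub hk hν hi, ← h0, ← Nat.mul_sub]
  congr 1
  omega

/-! ### Which nodes are asked for a part in layer 1 -/

/-- The cyclic pattern on the first `k` nodes is constant on blocks of `g = gcd(k, n - k)` nodes, so
that it can be described by a rotation of the block index `l / g`. -/
theorem part_eq {n k : ℕ} (hk : 0 < k) (hkn : k < n) (t l : ℕ) :
    part n k t l =
      if l < k then
        if (l / k.gcd (n - k) + (baseDim n k - t % baseDim n k)) % baseDim n k <
            (n - k) % k / k.gcd (n - k) then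
          .stripe (t / baseDim n k * subdiv n k +
            (l / k.gcd (n - k) + (baseDim n k - t % baseDim n k)) % baseDim n k)
        else .mask t
      else if l < ((n - k) / k + 1) * k then
        .stripe (t / baseDim n k * subdiv n k +
          ((n - k) % k / k.gcd (n - k) + (l / k - 1) * baseDim n k + t % baseDim n k))
      else .mask t := by
  have hg : 0 < k.gcd (n - k) := Nat.gcd_pos_of_pos_left _ hk
  have hdg := baseDim_mul_gcd hkn
  have hgr : k.gcd (n - k) ∣ (n - k) % k :=
    (Nat.dvd_mod_iff (Nat.gcd_dvd_left _ _)).2 (Nat.gcd_dvd_right _ _)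
  have hd : 0 < baseDim n k := Nat.pos_of_ne_zero fun h => by rw [h] at hdg; omega
  unfold part
  dsimp only
  generalize baseDim n k = d at *
  generalize k.gcd (n - k) = g at *
  have hj := Nat.mod_lt t hd
  generalize t % d = j at *
  obtain ⟨ρ, hρ⟩ := hgr
  have hρ' : (n - k) % k / g = ρ := by rw [hρ]; exact Nat.mul_div_cancel_left _ hg
  have hp : (l + (k - j * g)) % k = l % g + g * ((l / g + (d - j)) % d) := by
    have h1 : l + (k - j * g) = g * (l / g + (d - j)) + l % g := by
      rw [← hdg, ← Nat.sub_mul]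
      have := Nat.div_add_mod l g
      rw [mul_add, mul_comm (d - j) g]
      omega
    rw [h1, ← hdg, mul_comm d g, Nat.mod_mul, Nat.mul_add_mod, Nat.mod_mod,
      Nat.mul_add_div hg, Nat.div_eq_of_lt (Nat.mod_lt _ hg), add_zero]
  have hlg := Nat.mod_lt l hg
  simp only [hp, hρ, Nat.mul_div_cancel_left _ hg]
  have hlt : l % g + g * ((l / g + (d - j)) % d) < g * ρ ↔ (l / g + (d - j)) % d < ρ := by
    constructor
    · intro h
      by_contra hc
      have := Nat.mul_le_mul_left g (not_lt.1 hc)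
      omega
    · intro h
      have := Nat.mul_le_mul_left g (Nat.succ_le_of_lt h)
      rw [Nat.mul_succ] at this
      omega
  simp only [hlt, Nat.add_mul_div_left _ _ hg, Nat.div_eq_of_lt hlg, zero_add, add_assoc]

theorem subdiv_eq {n k : ℕ} (hk : 0 < k) (hkn : k < n) :
    subdiv n k = (n - k) % k / k.gcd (n - k) + (n - k) / k * baseDim n k := by
  have hg : 0 < k.gcd (n - k) := Nat.gcd_pos_of_pos_left _ hk
  have hdg := baseDim_mul_gcd hkn
  have hgr : k.gcd (n - k) ∣ (n - k) % k :=
    (Nat.dvd_mod_iff (Nat.gcd_dvd_left _ _)).2 (Nat.gcd_dvd_right _ _)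
  refine Nat.eq_of_mul_eq_mul_right hg ?_
  rw [subdiv_mul_gcd hk, add_mul, Nat.div_mul_cancel hgr, mul_assoc, hdg]
  have := Nat.div_add_mod (n - k) k
  rw [mul_comm] at this
  omega

theorem baseDim_pos {n k : ℕ} (hk : 0 < k) (hkn : k < n) : 0 < baseDim n k :=
  Nat.pos_of_ne_zero fun h => by
    have := baseDim_mul_gcd hkn
    rw [h] at this; omega

theorem part_eq_mask {n k t t' l : ℕ} (h : part n k t l = .mask t') : t = t' := by
  unfold part at h
  dsimp only at h
  split_ifs at h <;> simpa using h

/-- The nodes that are asked for stripe `a` in layer 1, by number. Either the nodes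
`0, …, k - 1` ask for stripe `a`, by the cyclic pattern, or the nodes of one of
the following blocks of `k` nodes. -/
def stripeNodes (n k a : ℕ) : Finset ℕ :=
  if a % subdiv n k < (n - k) % k / k.gcd (n - k) then range k
  else Ico (((a % subdiv n k - (n - k) % k / k.gcd (n - k)) / baseDim n k + 1) * k)
    (((a % subdiv n k - (n - k) % k / k.gcd (n - k)) / baseDim n k + 1) * k + k)

theorem card_stripeNodes (n k a : ℕ) : #(stripeNodes n k a) = k := by
  unfold stripeNodes; split_ifs <;> simp

theorem stripeNodes_subset {n k : ℕ} (hk : 0 < k) (hkn : k < n) (a : ℕ) :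
    stripeNodes n k a ⊆ range n := by
  have hlt := Nat.mod_lt a (subdiv_pos hk hkn)
  have hs := subdiv_eq hk hkn
  have hd := baseDim_pos hk hkn
  unfold stripeNodes
  intro l hl
  rw [Finset.mem_range]
  split_ifs at hl with h
  · exact (Finset.mem_range.1 hl).trans hkn
  · have hq : (a % subdiv n k - (n - k) % k / k.gcd (n - k)) / baseDim n k < (n - k) / k := by
      rw [Nat.div_lt_iff_lt_mul hd]; omega
    have h1 := (Finset.mem_Ico.1 hl).2
    have h2 := Nat.mul_le_mul_right k (Nat.succ_le_of_lt hq)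
    have h3 := Nat.div_mul_le_self (n - k) k
    rw [Nat.succ_mul] at h2
    rw [Nat.add_mul, one_mul] at h1
    omega

theorem mul_add_inj {s c c' x x' : ℕ} (hx : x < s) (hx' : x' < s)
    (h : c * s + x = c' * s + x') : c = c' ∧ x = x' := by
  have hs : 0 < s := by omega
  have h1 := congrArg (· / s) h
  have h2 := congrArg (· % s) h
  simp only [mul_comm _ s, Nat.mul_add_div hs, Nat.mul_add_mod, Nat.div_eq_of_lt hx,
    Nat.div_eq_of_lt hx', Nat.mod_eq_of_lt hx, Nat.mod_eq_of_lt hx'] at h1 h2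
  exact ⟨h1, h2⟩

/-- Inversion of `part`: the copy `a / subdiv n k` and the position `a % subdiv n k` in it determine
the subquery in terms of the node. -/
theorem part_eq_stripe {n k t l a : ℕ} (hk : 0 < k) (hkn : k < n)
    (h : part n k t l = .stripe a) :
    (l < k ∧ a / subdiv n k = t / baseDim n k ∧
      a % subdiv n k = (l / k.gcd (n - k) + (baseDim n k - t % baseDim n k)) % baseDim n k ∧
      a % subdiv n k < (n - k) % k / k.gcd (n - k)) ∨
    (k ≤ l ∧ l < ((n - k) / k + 1) * k ∧ a / subdiv n k = t / baseDim n k ∧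
      a % subdiv n k =
        (n - k) % k / k.gcd (n - k) + (l / k - 1) * baseDim n k + t % baseDim n k) := by
  rw [part_eq hk hkn] at h
  have hs := subdiv_eq hk hkn
  have hs0 := subdiv_pos hk hkn
  have ha := Nat.div_add_mod a (subdiv n k)
  rw [mul_comm] at ha
  have hlt := Nat.mod_lt a hs0
  split_ifs at h with h1 h2 h3
  · simp only [Part.stripe.injEq] at h
    obtain ⟨e1, e2⟩ := mul_add_inj (by omega) hlt (h.trans ha.symm)
    exact Or.inl ⟨h1, e1.symm, e2.symm, by omega⟩
  · simp only [Part.stripe.injEq] at h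
    have hd := Nat.mod_lt t (baseDim_pos hk hkn)
    have hlk : l / k - 1 < (n - k) / k := by
      have := (Nat.div_lt_iff_lt_mul hk).2 h3
      have := Nat.div_pos (not_lt.1 h1) hk
      omega
    have := Nat.mul_le_mul_right (baseDim n k) (Nat.succ_le_of_lt hlk)
    rw [Nat.succ_mul] at this
    obtain ⟨e1, e2⟩ := mul_add_inj (by omega) hlt (h.trans ha.symm)
    exact Or.inr ⟨not_lt.1 h1, h3, e1.symm, e2.symm⟩

theorem mem_stripeNodes {n k t l a : ℕ} (hk : 0 < k) (hkn : k < n)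
    (h : part n k t l = .stripe a) : l ∈ stripeNodes n k a := by
  unfold stripeNodes
  rcases part_eq_stripe hk hkn h with ⟨h1, _, _, h4⟩ | ⟨h1, _, _, h4⟩
  · rw [if_pos h4]; exact Finset.mem_range.2 h1
  · rw [if_neg (by omega), h4]
    have hd := baseDim_pos hk hkn
    have hj := Nat.mod_lt t hd
    have hq : ((n - k) % k / k.gcd (n - k) + (l / k - 1) * baseDim n k + t % baseDim n k -
        (n - k) % k / k.gcd (n - k)) / baseDim n k = l / k - 1 := by
      rw [add_assoc, Nat.add_sub_cancel_left, mul_comm, Nat.mul_add_div hd, Nat.div_eq_of_lt hj,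
        add_zero]
    have h0 := Nat.div_pos h1 hk
    rw [hq, Nat.sub_add_cancel h0, Finset.mem_Ico]
    have := Nat.div_add_mod l k
    have := Nat.mod_lt l hk
    rw [mul_comm]
    omega

theorem exists_rotation {d x p : ℕ} (hp : p < d) (hx : x < d) :
    ∃ j < d, (x + (d - j)) % d = p := by
  by_cases h : p ≤ x
  · refine ⟨x - p, by omega, ?_⟩
    rw [show x + (d - (x - p)) = p + d by omega, Nat.add_mod_right, Nat.mod_eq_of_lt hp]
  · refine ⟨x + d - p, by omega, ?_⟩
    rw [show x + (d - (x + d - p)) = p by omega, Nat.mod_eq_of_lt hp]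

theorem rotation_inj {d x j j' : ℕ} (hj : j < d) (hj' : j' < d)
    (h : (x + (d - j)) % d = (x + (d - j')) % d) : j = j' := by
  have h1 : d - j ≡ d - j' [MOD d] := Nat.ModEq.add_left_cancel' x h
  have h2 : j + (d - j) ≡ j' + (d - j') [MOD d] := by
    rw [Nat.add_sub_cancel' hj.le, Nat.add_sub_cancel' hj'.le]
  have h3 : j ≡ j' [MOD d] := Nat.ModEq.add_right_cancel h1 h2
  exact Nat.ModEq.eq_of_lt_of_lt h3 hj hj'

/-- Every node of `stripeNodes n k a` asks for the stripe `a` in some subquery of layer 1. -/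
theorem exists_part_eq_stripe {n k ν a l : ℕ} (hk : 0 < k) (hkn : k < n) (ha : a < alpha n k ν)
    (hl : l ∈ stripeNodes n k a) : ∃ t < dim n k ν 0, part n k t l = .stripe a := by
  have hs := subdiv_eq hk hkn
  have hs0 := subdiv_pos hk hkn
  have hd := baseDim_pos hk hkn
  have hdg := baseDim_mul_gcd hkn
  have hg : 0 < k.gcd (n - k) := Nat.gcd_pos_of_pos_left _ hk
  have hln := Finset.mem_range.1 (stripeNodes_subset hk hkn a hl)
  have hr : (n - k) % k / k.gcd (n - k) < baseDim n k := by
    rw [Nat.div_lt_iff_lt_mul hg, hdg]; exact Nat.mod_lt _ hk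
  have ha' := Nat.div_add_mod a (subdiv n k)
  rw [mul_comm] at ha'
  have hlt := Nat.mod_lt a hs0
  -- the copy is `a / subdiv n k`; `j` is the subquery within the copy
  suffices hj : ∃ j < baseDim n k,
      part n k (baseDim n k * (a / subdiv n k) + j) l = .stripe a by
    obtain ⟨j, hj, h⟩ := hj
    refine ⟨_, ?_, h⟩
    have h1 : a / subdiv n k < alpha n k ν / subdiv n k :=
      Nat.div_lt_div_of_lt_of_dvd (subdiv_dvd_alpha (i := 0) (Nat.zero_le ν)) ha
    have h2 := Nat.mul_le_mul_left (baseDim n k) (Nat.succ_le_of_lt h1)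
    rw [Nat.mul_succ] at h2
    exact (Nat.add_lt_add_left hj _).trans_le h2
  unfold stripeNodes at hl
  split_ifs at hl with h
  · have hl' := Finset.mem_range.1 hl
    have hx : l / k.gcd (n - k) < baseDim n k := by
      rw [Nat.div_lt_iff_lt_mul hg, hdg]; exact hl'
    obtain ⟨j, hj, hjp⟩ := exists_rotation (h.trans hr) hx
    refine ⟨j, hj, ?_⟩
    rw [part_eq hk hkn, if_pos hl', Nat.mul_add_div hd, Nat.mul_add_mod, Nat.mod_eq_of_lt hj,
      Nat.div_eq_of_lt hj, hjp, if_pos h, add_zero, ha']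
  · set e := a % subdiv n k - (n - k) % k / k.gcd (n - k) with he
    have hl' := Finset.mem_Ico.1 hl
    refine ⟨e % baseDim n k, Nat.mod_lt _ hd, ?_⟩
    have hq : e / baseDim n k < (n - k) / k := by
      rw [Nat.div_lt_iff_lt_mul hd]; omega
    have hlk : l / k = e / baseDim n k + 1 :=
      Nat.div_eq_of_lt_le hl'.1 (by rw [Nat.succ_mul]; exact hl'.2)
    have h1 : ¬ l < k := fun hc => by
      rw [Nat.div_eq_of_lt hc] at hlk; exact Nat.succ_ne_zero _ hlk.symm
    have h2 : l < ((n - k) / k + 1) * k := by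
      rw [← Nat.div_lt_iff_lt_mul hk]; omega
    have h3 := Nat.div_add_mod e (baseDim n k)
    rw [mul_comm] at h3
    rw [part_eq hk hkn, if_neg h1, if_pos h2, Nat.mul_add_div hd, Nat.mul_add_mod, Nat.mod_mod,
      Nat.div_eq_of_lt (Nat.mod_lt _ hd), hlk, Nat.add_sub_cancel, add_zero, add_assoc, h3]
    congr 1
    omega

/-- No node asks for the same part in two subqueries of layer 1. -/
theorem part_injective_left {n k t t' l : ℕ} (hk : 0 < k) (hkn : k < n)
    (h : part n k t l = part n k t' l) : t = t' := by
  rcases hp : part n k t' l with a | t''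
  · have hd := baseDim_pos hk hkn
    have h1 := part_eq_stripe hk hkn (h.trans hp)
    have h2 := part_eq_stripe hk hkn hp
    have e : t / baseDim n k = t' / baseDim n k ∧ t % baseDim n k = t' % baseDim n k := by
      rcases h1 with ⟨b1, b2, b3, b4⟩ | ⟨b1, b2, b3, b4⟩ <;>
        rcases h2 with ⟨c1, c2, c3, c4⟩ | ⟨c1, c2, c3, c4⟩
      · exact ⟨b2.symm.trans c2,
          rotation_inj (Nat.mod_lt _ hd) (Nat.mod_lt _ hd) (b3.symm.trans c3)⟩
      · omega
      · omega
      · exact ⟨b3.symm.trans c3, by omega⟩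
    rw [← Nat.div_add_mod t (baseDim n k), ← Nat.div_add_mod t' (baseDim n k), e.1, e.2]
  · rw [hp] at h
    rw [part_eq_mask h, part_eq_mask hp]

theorem card_filter_part_eq_mask {n k : ℕ} (hk : 0 < k) (hkn : k < n) (t : ℕ) :
    #{l ∈ range n | part n k t l = .mask t} = k := by
  set s := k - t % baseDim n k * Nat.gcd k (n - k) with hs
  have hβ : (n - k) / k * k + (n - k) % k = n - k := Nat.div_add_mod' _ _
  have h1 : #{l ∈ range n | ¬ part n k t l = .mask t} = n - k := by
    have hset : {l ∈ range n | ¬ part n k t l = .mask t} =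
        {l ∈ range k | (l + s) % k < (n - k) % k} ∪ Ico k (((n - k) / k + 1) * k) := by
      ext l
      simp only [Finset.mem_filter, Finset.mem_range, Finset.mem_union, Finset.mem_Ico]
      unfold part
      dsimp only
      rw [← hs]
      rw [Nat.add_mul, one_mul]
      split_ifs <;> simp <;> omega
    rw [hset, Finset.card_union_of_disjoint]
    · have hper : Function.Periodic (fun x => x % k < (n - k) % k) k := fun x => by
        simp
      have h2 := Nat.filter_Ico_card_eq_of_periodic s k (fun x => x % k < (n - k) % k) hper
      have h3 : #{l ∈ range k | (l + s) % k < (n - k) % k} =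
          #{x ∈ Ico s (s + k) | x % k < (n - k) % k} := by
        refine Finset.card_bij (fun l _ => l + s) ?_ ?_ ?_
        · intro l hl
          simp only [Finset.mem_filter, Finset.mem_range, Finset.mem_Ico] at hl ⊢
          exact ⟨by omega, hl.2⟩
        · intro l _ l' _ h; omega
        · intro x hx
          simp only [Finset.mem_filter, Finset.mem_Ico] at hx
          refine ⟨x - s, ?_, by omega⟩
          rw [Finset.mem_filter, Nat.sub_add_cancel hx.1.1]
          exact ⟨Finset.mem_range.2 (by omega), hx.2⟩
      have h4 : k.count (fun x => x % k < (n - k) % k) = (n - k) % k := by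
        rw [Nat.count_eq_card_filter_range]
        have : {x ∈ range k | x % k < (n - k) % k} = range ((n - k) % k) := by
          ext x
          simp only [Finset.mem_filter, Finset.mem_range]
          have := Nat.mod_lt (n - k) hk
          constructor
          · rintro ⟨a, b⟩; rwa [Nat.mod_eq_of_lt a] at b
          · intro a; exact ⟨a.trans this, by rwa [Nat.mod_eq_of_lt (a.trans this)]⟩
        rw [this, Finset.card_range]
      rw [h3, h2, h4, Nat.card_Ico, Nat.add_mul, one_mul, Nat.add_sub_cancel]
      omega
    · rw [Finset.disjoint_left]
      intro l hl hl'
      simp only [Finset.mem_filter, Finset.mem_range, Finset.mem_Ico] at hl hl'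
      omega
  have h5 := Finset.card_filter_add_card_filter_not (s := range n)
    fun l => part n k t l = .mask t
  rw [Finset.card_range] at h5
  omega

/-- The nodes that are asked for the part `p` in layer 1. -/
def askers (n k ν : ℕ) (p : Part) : Finset (Fin n) :=
  {l | ∃ t : Fin (dim n k ν 0), part n k t l = p}

theorem askers_mask {n k ν : ℕ} (t : Fin (dim n k ν 0)) :
    (askers n k ν (.mask t)).map Fin.valEmbedding = {l ∈ range n | part n k t l = .mask t} := by
  ext l
  simp only [askers, Finset.mem_map, Finset.mem_filter, Finset.mem_univ, true_and,
    Fin.valEmbedding_apply, Finset.mem_range]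
  constructor
  · rintro ⟨l, ⟨t', h⟩, rfl⟩
    exact ⟨l.2, by rwa [part_eq_mask h] at h⟩
  · rintro ⟨hl, h⟩
    exact ⟨⟨l, hl⟩, ⟨t, h⟩, rfl⟩

theorem card_askers_mask {n k ν : ℕ} (hk : 0 < k) (hkn : k < n) (t : Fin (dim n k ν 0)) :
    #(askers n k ν (.mask t)) = k := by
  rw [← Finset.card_map Fin.valEmbedding, askers_mask, card_filter_part_eq_mask hk hkn]

theorem askers_stripe_subset {n k ν : ℕ} (hk : 0 < k) (hkn : k < n) (a : ℕ) :
    (askers n k ν (.stripe a)).map Fin.valEmbedding ⊆ stripeNodes n k a := by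
  intro l
  simp only [askers, Finset.mem_map, Finset.mem_filter, Finset.mem_univ, true_and,
    Fin.valEmbedding_apply]
  rintro ⟨l, ⟨t', h⟩, rfl⟩
  exact mem_stripeNodes hk hkn h

theorem card_askers_stripe {n k ν a : ℕ} (hk : 0 < k) (hkn : k < n) (ha : a < alpha n k ν) :
    #(askers n k ν (.stripe a)) = k := by
  rw [← Finset.card_map Fin.valEmbedding]
  refine (congrArg Finset.card ?_).trans (card_stripeNodes n k a)
  refine Finset.Subset.antisymm (askers_stripe_subset hk hkn a) fun l hl => ?_
  obtain ⟨t, ht, h⟩ := exists_part_eq_stripe hk hkn ha hl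
  simp only [askers, Finset.mem_map, Finset.mem_filter, Finset.mem_univ, true_and,
    Fin.valEmbedding_apply]
  exact ⟨⟨l, Finset.mem_range.1 (stripeNodes_subset hk hkn a hl)⟩, ⟨⟨t, ht⟩, h⟩, rfl⟩

theorem card_askers_part_le {n k ν : ℕ} (hk : 0 < k) (hkn : k < n) (t : Fin (dim n k ν 0))
    (l : ℕ) : #(askers n k ν (part n k t l)) ≤ k := by
  rcases hp : part n k t l with a | t'
  · rw [← Finset.card_map Fin.valEmbedding]
    exact (Finset.card_le_card (askers_stripe_subset hk hkn a)).trans (card_stripeNodes n k a).le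
  · rw [← part_eq_mask hp]
    exact (card_askers_mask hk hkn t).le

end TwoLayer

namespace TwoLayer

/-! ### Existence of the choices for the second layer -/

/-- A set of `c * D` elements whose classes under `f` have at most `D` elements can be split into
`D` groups of size `c` that meet every class at most once: list the elements class by class and
deal them out cyclically. -/
theorem exists_balanced_groups {X Y : Type*} [Fintype X] [LinearOrder Y] (f : X → Y) {c D : ℕ}
    (hX : Fintype.card X = c * D) (hf : ∀ y, #{x | f x = y} ≤ D) :
    ∃ g : X → Fin D, (∀ s, #{x | g x = s} = c) ∧ ∀ x y, g x = g y → f x = f y → x = y := by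
  classical
  let e₀ : X ≃ Fin (c * D) := Fintype.equivFinOfCardEq hX
  let σ := Tuple.sort (f ∘ e₀.symm)
  have hσ : Monotone ((f ∘ e₀.symm) ∘ σ) := Tuple.monotone_sort _
  let e : X ≃ Fin (c * D) := e₀.trans σ.symm
  have he : Monotone (f ∘ e.symm) := hσ
  let e' : X ≃ Fin c × Fin D := e.trans finProdFinEquiv.symm
  have hval : ∀ x, (e x).val = (e' x).2.val + D * (e' x).1.val := by
    intro x
    have : e x = finProdFinEquiv (e' x) := (Equiv.apply_symm_apply finProdFinEquiv (e x)).symm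
    rw [this]; rfl
  have key : ∀ x y, (e' x).2 = (e' y).2 → f x = f y → ¬ e x < e y := by
    intro x y hg hxy hlt
    have h1 : (e x).val + D ≤ (e y).val := by
      have h2 : (e' x).1.val < (e' y).1.val := by
        by_contra hc
        have := Nat.mul_le_mul_left D (not_lt.1 hc)
        have h3 : (e x).val < (e y).val := hlt
        rw [hval, hval, hg] at h3
        omega
      have := Nat.mul_le_mul_left D (Nat.succ_le_of_lt h2)
      rw [Nat.mul_succ] at this
      rw [hval, hval, hg]
      omega
    have h2 : #(Finset.Icc (e x) (e y)) ≤ #{z | f z = f x} := by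
      refine Finset.card_le_card_of_injOn e.symm (fun i hi => ?_) e.symm.injective.injOn
      have hi' := Finset.mem_Icc.1 hi
      have a := he hi'.1
      have b := he hi'.2
      simp only [Function.comp_apply, Equiv.symm_apply_apply] at a b
      rw [← hxy] at b
      simpa using le_antisymm b a
    rw [Fin.card_Icc] at h2
    have := hf (f x)
    omega
  refine ⟨fun x => (e' x).2, fun s => ?_, fun x y hg hxy => ?_⟩
  · have : ({x | (e' x).2 = s} : Finset X).map e'.toEmbedding =
        (Finset.univ : Finset (Fin c)) ×ˢ {s} := by
      ext ⟨a, b⟩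
      simp only [Finset.mem_map_equiv, Finset.mem_filter, Finset.mem_univ, true_and,
        Equiv.apply_symm_apply, Finset.mem_product, Finset.mem_singleton]
    rw [← Finset.card_map e'.toEmbedding, this]
    simp
  · rcases lt_trichotomy (e x) (e y) with h | h | h
    · exact absurd h (key x y hg hxy)
    · exact e.injective h
    · exact absurd h (key y x hg.symm hxy.symm)

variable {n k ν : ℕ} {S : Finset (Fin n)}

theorem mem_askers_part (x : Missing n k ν S) : x.2.1 ∈ askers n k ν x.part := by
  simp only [askers, Finset.mem_filter, Finset.mem_univ, true_and]
  exact ⟨x.1, rfl⟩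

theorem missing_eq (hk : 0 < k) (hkn : k < n) {x y : Missing n k ν S} (h : x.part = y.part)
    (h2 : x.2 = y.2) : x = y := by
  refine Prod.ext (Fin.ext ?_) h2
  unfold Missing.part at h
  rw [h2] at h
  exact part_injective_left hk hkn h

/-- The number of missing copies of a part is at most the number of unresponsive nodes asked for
it. -/
theorem card_missing_part_le (hk : 0 < k) (hkn : k < n) (p : Part) :
    #{y : Missing n k ν S | y.part = p} ≤ #{l ∈ askers n k ν p | l ∈ S} := by
  refine Finset.card_le_card_of_injOn (fun y => y.2.1) (fun y hy => ?_) fun y hy z hz h => ?_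
  · have hy' := (Finset.mem_filter.1 hy).2
    simp only [Finset.coe_filter, Set.mem_ofPred_eq]
    exact ⟨hy' ▸ mem_askers_part y, y.2.2⟩
  · have hy' := (Finset.mem_filter.1 hy).2
    have hz' := (Finset.mem_filter.1 hz).2
    exact missing_eq hk hkn (hy'.trans hz'.symm) (Subtype.ext h)

theorem card_missing (hk : 0 < k) (hν : ν + k < n) (hS : #S ≤ ν) :
    Fintype.card (Missing n k ν S) = (n - #S - k) * (dim n k ν #S - dim n k ν 0) := by
  rw [mul_comm, dim_sub_mul hk hν hS]
  simp

open Classical in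
/-- Responsive nodes can be chosen greedily for the missing parts. Of the `n - |S|` responsive
nodes, at most `k - 1` are excluded because they are asked for the same part in layer 1 or layer 2,
and at most `n - |S| - k - 1` because they already have one part in each new subquery. -/
theorem exists_node_assignment (hk : 0 < k) (hν : ν + k < n) (hS : #S ≤ ν)
    (T : Finset (Missing n k ν S)) :
    ∃ node : Missing n k ν S → {l // l ∉ S}, (∀ x ∈ T, (node x).1 ∉ askers n k ν x.part) ∧
      (∀ x ∈ T, ∀ y ∈ T, x.part = y.part → node x = node y → x = y) ∧
      ∀ l, #{x ∈ T | node x = l} ≤ dim n k ν #S - dim n k ν 0 := by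
  have hcardR : Fintype.card {l // l ∉ S} = n - #S := by
    rw [Fintype.card_subtype_compl]; simp
  induction T using Finset.induction_on with
  | empty =>
    have : Nonempty {l // l ∉ S} := Fintype.card_pos_iff.1 (by omega)
    exact ⟨fun _ => Classical.arbitrary _, by simp, by simp, by simp⟩
  | insert x T hx ih =>
    obtain ⟨node, h1, h2, h3⟩ := ih
    set D := dim n k ν #S - dim n k ν 0
    let E₁ : Finset {l // l ∉ S} := {l | l.1 ∈ askers n k ν x.part}
    let E₂ : Finset {l // l ∉ S} := ({y ∈ T | y.part = x.part} : Finset _).image node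
    let E₃ : Finset {l // l ∉ S} := {l | D ≤ #{y ∈ T | node y = l}}
    have c1 : #E₁ ≤ #{l ∈ askers n k ν x.part | l ∉ S} :=
      Finset.card_le_card_of_injOn (fun l => l.1)
        (fun l hl => by
          have := (Finset.mem_filter.1 hl).2
          simp only [Finset.coe_filter, Set.mem_ofPred_eq]
          exact ⟨this, l.2⟩) Subtype.val_injective.injOn
    have c2 : #E₂ + 1 ≤ #{l ∈ askers n k ν x.part | l ∈ S} := by
      refine le_trans ?_ (card_missing_part_le hk (by omega) x.part)
      have hnot : x ∉ ({y ∈ T | y.part = x.part} : Finset _) := fun h =>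
        hx (Finset.mem_filter.1 h).1
      have : #(insert x ({y ∈ T | y.part = x.part} : Finset _)) ≤
          #{y : Missing n k ν S | y.part = x.part} := by
        refine Finset.card_le_card fun y hy => ?_
        rcases Finset.mem_insert.1 hy with rfl | hy
        · simp
        · simpa using (Finset.mem_filter.1 hy).2
      rw [Finset.card_insert_of_notMem hnot] at this
      exact (Nat.add_le_add_right Finset.card_image_le 1).trans this
    have c12 : #{l ∈ askers n k ν x.part | l ∈ S} + #{l ∈ askers n k ν x.part | l ∉ S} ≤ k := by
      rw [Finset.card_filter_add_card_filter_not]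
      exact card_askers_part_le hk (by omega) x.1 x.2.1
    have c3 : #E₃ < n - #S - k := by
      have hT : #T < (n - #S - k) * D := by
        rw [← card_missing hk hν hS]
        exact Finset.card_lt_univ_of_notMem hx
      have hE : #E₃ * D ≤ #T := by
        rw [Finset.card_eq_sum_card_fiberwise (s := T) (t := Finset.univ) (f := node)
          fun _ _ => Finset.mem_coe.2 (Finset.mem_univ _)]
        refine (Finset.card_nsmul_le_sum E₃ _ D fun l hl => (Finset.mem_filter.1 hl).2).trans ?_
        exact Finset.sum_le_sum_of_subset (Finset.subset_univ _)
      exact lt_of_mul_lt_mul_right (hE.trans_lt hT) (Nat.zero_le D)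
    obtain ⟨l, hl⟩ : ∃ l, l ∉ E₁ ∪ E₂ ∪ E₃ := by
      by_contra! hc
      have hu : #(E₁ ∪ E₂ ∪ E₃) = n - #S := by
        rw [Finset.eq_univ_iff_forall.2 hc, Finset.card_univ, hcardR]
      have := Finset.card_union_le (E₁ ∪ E₂) E₃
      have := Finset.card_union_le E₁ E₂
      omega
    simp only [Finset.mem_union, not_or] at hl
    obtain ⟨⟨hl1, hl2⟩, hl3⟩ := hl
    have hne : ∀ y ∈ T, y ≠ x := fun y hy h => hx (h ▸ hy)
    have hfresh : ∀ y ∈ T, y.part = x.part → node y ≠ l := fun y hy hyx h =>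
      hl2 (Finset.mem_image.2 ⟨y, Finset.mem_filter.2 ⟨hy, hyx⟩, h⟩)
    refine ⟨Function.update node x l, fun y hy => ?_, fun y hy z hz hyz hn => ?_, fun l' => ?_⟩
    · rcases Finset.mem_insert.1 hy with rfl | hy
      · rw [Function.update_self]
        exact fun h => hl1 (Finset.mem_filter.2 ⟨Finset.mem_univ _, h⟩)
      · rw [Function.update_of_ne (hne y hy)]
        exact h1 y hy
    · rcases Finset.mem_insert.1 hy with rfl | hyT <;> rcases Finset.mem_insert.1 hz with rfl | hzT
      · rfl
      · rw [Function.update_self, Function.update_of_ne (hne z hzT)] at hn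
        exact absurd hn.symm (hfresh z hzT hyz.symm)
      · rw [Function.update_self, Function.update_of_ne (hne y hyT)] at hn
        exact absurd hn (hfresh y hyT hyz)
      · rw [Function.update_of_ne (hne y hyT), Function.update_of_ne (hne z hzT)] at hn
        exact h2 y hyT z hzT hyz hn
    · have hT : ({y ∈ T | Function.update node x l y = l'} : Finset _) =
          {y ∈ T | node y = l'} :=
        Finset.filter_congr fun y hy => by rw [Function.update_of_ne (hne y hy)]
      rw [Finset.filter_insert, Function.update_self, hT]
      split_ifs with h
      · have hl3' : #{y ∈ T | node y = l} < D := by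
          by_contra hc
          exact hl3 (Finset.mem_filter.2 ⟨Finset.mem_univ _, not_lt.1 hc⟩)
        refine (Finset.card_insert_le _ _).trans ?_
        rw [← h]
        exact hl3'
      · exact h3 l'

theorem nonempty_plan (hk : 0 < k) (hν : ν + k < n) (hS : #S ≤ ν) : Nonempty (Plan n k ν S) := by
  classical
  obtain ⟨node, h1, h2, h3⟩ := exists_node_assignment hk hν hS (S := S) Finset.univ
  obtain ⟨group, g1, g2⟩ := exists_balanced_groups (fun x => node x) (card_missing hk hν hS)
    fun l => by convert h3 l
  exact ⟨{
    group := group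
    node := node
    card_group := fun s => by convert g1 s
    one_per_query := g2
    fresh_layer1 := fun x t h => h1 x (Finset.mem_univ _) (by
      simp only [askers, Finset.mem_filter, Finset.mem_univ, true_and]
      exact ⟨t, h⟩)
    fresh_layer2 := fun x y => h2 x (Finset.mem_univ _) y (Finset.mem_univ _) }⟩

end TwoLayer

namespace TwoLayer

/-! ### Privacy of the two-layer scheme -/

section Queries

variable {F : Type u} [Field F] {n k ν m : ℕ} {S : Finset (Fin n)}

theorem query1_of_stripe (f : Fin m) (U : Fin (dim n k ν 0) → Fin m × Fin (alpha n k ν) → F)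
    {t : Fin (dim n k ν 0)} {l : Fin n} {a : ℕ} (h : part n k t l = .stripe a) :
    query1 f U t l = U t + unitVec F m (alpha n k ν) f a := by
  unfold query1; rw [h]

theorem query1_of_mask (f : Fin m) (U : Fin (dim n k ν 0) → Fin m × Fin (alpha n k ν) → F)
    {t : Fin (dim n k ν 0)} {l : Fin n} {t' : ℕ} (h : part n k t l = .mask t') :
    query1 f U t l = U t := by
  unfold query1; rw [h]

theorem hidden_of_stripe (f : Fin m) (U : Fin (dim n k ν 0) → Fin m × Fin (alpha n k ν) → F)
    {x : Missing n k ν S} {a : ℕ} (h : x.part = .stripe a) :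
    hidden f U x = unitVec F m (alpha n k ν) f a := by
  unfold hidden; rw [h]

theorem hidden_of_mask (f : Fin m) (U : Fin (dim n k ν 0) → Fin m × Fin (alpha n k ν) → F)
    {x : Missing n k ν S} {t : ℕ} (h : x.part = .mask t) : hidden f U x = U x.1 := by
  unfold hidden; rw [h]

theorem query1_eq_add (f : Fin m) (U : Fin (dim n k ν 0) → Fin m × Fin (alpha n k ν) → F)
    (t : Fin (dim n k ν 0)) (l : Fin n) : query1 f U t l = U t + query1 f 0 t l := by
  rcases h : part n k t l with a | t'
  · rw [query1_of_stripe f U h, query1_of_stripe f 0 h, Pi.zero_apply, zero_add]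
  · rw [query1_of_mask f U h, query1_of_mask f 0 h, Pi.zero_apply, add_zero]

theorem query2_eq_add (A : Plan n k ν S) (f : Fin m)
    (U : Fin (dim n k ν 0) → Fin m × Fin (alpha n k ν) → F)
    (V : Fin (dim n k ν #S - dim n k ν 0) → Fin m × Fin (alpha n k ν) → F)
    (s : Fin (dim n k ν #S - dim n k ν 0)) (l : Fin n) :
    query2 A f U V s l = V s + query2 A f U 0 s l := by
  unfold query2
  split_ifs <;> simp

theorem query2_of_forall_ne (A : Plan n k ν S) (f : Fin m)
    (U : Fin (dim n k ν 0) → Fin m × Fin (alpha n k ν) → F)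
    (V : Fin (dim n k ν #S - dim n k ν 0) → Fin m × Fin (alpha n k ν) → F)
    {s : Fin (dim n k ν #S - dim n k ν 0)} {l : Fin n}
    (h : ∀ x, A.group x = s → (A.node x).1 ≠ l) : query2 A f U V s l = V s :=
  dif_neg fun ⟨x, hx, hxl⟩ => h x hx hxl

theorem query2_group_node (A : Plan n k ν S) (f : Fin m)
    (U : Fin (dim n k ν 0) → Fin m × Fin (alpha n k ν) → F)
    (V : Fin (dim n k ν #S - dim n k ν 0) → Fin m × Fin (alpha n k ν) → F)
    (x : Missing n k ν S) :
    query2 A f U V (A.group x) (A.node x) = V (A.group x) + hidden f U x := by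
  have h : ∃ y, A.group y = A.group x ∧ (A.node y).1 = (A.node x).1 := ⟨x, rfl, rfl⟩
  have hx : h.choose = x :=
    A.one_per_query _ _ h.choose_spec.1 (Subtype.ext h.choose_spec.2)
  unfold query2
  rw [dif_pos h, hx]

/-- For a fixed file and node, adding the requested parts to the random vectors is a bijection:
the vectors of the second layer are translated by an amount that depends on the first layer
only. -/
noncomputable def maskEquiv (A : Plan n k ν S) (f : Fin m) (l : Fin n) :
    Masks F n k ν m #S ≃ Masks F n k ν m #S where
  toFun ω := (fun t => ω.1 t + query1 f 0 t l, fun s => ω.2 s + query2 A f ω.1 0 s l)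
  invFun ω := (fun t => ω.1 t - query1 f 0 t l,
    fun s => ω.2 s - query2 A f (fun t => ω.1 t - query1 f 0 t l) 0 s l)
  left_inv ω := by simp
  right_inv ω := by simp

end Queries

variable {F : Type u} {K : Type v} [Field F] [Fintype F] [Field K] [Algebra F K] {n k ν m : ℕ}
  {S : Finset (Fin n)}

theorem scheme_query_eq (A : Fin m → Plan n k ν S) (f : Fin m) (ω : Masks F n k ν m #S)
    (l : Fin n) :
    (scheme (F := F) S A).query f ω l =
      Matrix.of (Fin.addCases (maskEquiv (A f) f l ω).1 fun s =>
        (maskEquiv (A f) f l ω).2 (Fin.castLE (extra_le S l) s)) := by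
  have h1 : (fun t => query1 f ω.1 t l) = (maskEquiv (A f) f l ω).1 :=
    funext fun t => query1_eq_add f ω.1 t l
  have h2 : (fun s => query2 (A f) f ω.1 ω.2 s l) = (maskEquiv (A f) f l ω).2 :=
    funext fun s => query2_eq_add (A f) f ω.1 ω.2 s l
  rw [← h1, ← h2]
  rfl

variable (K) in
theorem scheme_isPrivate (hm : 0 < m) (A : Fin m → Plan n k ν S) :
    ((scheme (F := F) S A).toPIRScheme K).IsPrivate := by
  classical
  rw [PIRScheme.isPrivate_iff _ hm]
  -- the law of the query is that of the random vectors themselves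
  suffices h : ∀ l f q, ((scheme (F := F) S A).toPIRScheme K).joint l f q =
      ∑ ω : Masks F n k ν m #S, if (Matrix.of (Fin.addCases ω.1 fun s =>
        ω.2 (Fin.castLE (extra_le S l) s)) :
          Matrix (Fin (dim n k ν 0 + extra n k ν S l)) _ F) = q
        then 1 / (Nat.card (Masks F n k ν m #S) : ℝ) / m else 0 from
    fun l f f' q => (h l f q).trans (h l f' q).symm
  intro l f q
  rw [← Equiv.sum_comp (maskEquiv (A f) f l)]
  unfold PIRScheme.joint
  refine Finset.sum_congr rfl fun ω _ => ?_
  rw [← scheme_query_eq A f ω l]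
  by_cases hq : (scheme (F := F) S A).query f ω l = q
  · exact (if_pos hq).trans (if_pos hq).symm
  · exact (if_neg hq).trans (if_neg hq).symm

/-! ### Price of the two-layer scheme -/

variable (F K) in
theorem scheme_cPoP (hk : 0 < k) (hν : ν + k < n) (hS : #S ≤ ν) (hm : 0 < m)
    (A : Fin m → Plan n k ν S) :
    ((scheme (F := F) S A).toPIRScheme K).cPoP k Sᶜ = ((n : ℝ) - #S) / ((n : ℝ) - #S - k) := by
  have hm' : (m : ℝ) ≠ 0 := by exact_mod_cast hm.ne'
  set P := (scheme (F := F) S A).toPIRScheme K with hP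
  have h1 : ∀ l ∈ Sᶜ, ∑ f, ∑ ω, P.prob ω / m * (P.len l (P.query f ω l) : ℝ) = dim n k ν #S := by
    intro l hl
    have hlen : ∀ f ω, (P.len l (P.query f ω l) : ℝ) = dim n k ν #S := by
      intro f ω
      have : P.len l (P.query f ω l) = dim n k ν 0 + extra n k ν S l := rfl
      rw [this, extra, if_neg (Finset.mem_compl.1 hl),
        Nat.add_sub_cancel' (dim_zero_le hk hν hS)]
    simp_rw [hlen, ← Finset.sum_mul, ← Finset.sum_div, P.prob_sum]
    simp [hm']
  have hdim := dim_mul_sub hk hν hS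
  have hα := alpha_pos hk hν
  have hsub : ((n - #S - k : ℕ) : ℝ) = (n : ℝ) - #S - k := by
    rw [Nat.cast_sub (by omega), Nat.cast_sub (by omega)]
  have hpos : (0 : ℝ) < (n : ℝ) - #S - k := by
    rw [← hsub]; exact_mod_cast (by omega : 0 < n - #S - k)
  have hdim' : (dim n k ν #S : ℝ) * ((n : ℝ) - #S - k) = k * alpha n k ν := by
    rw [← hsub]; exact_mod_cast hdim
  unfold PIRScheme.cPoP
  rw [Finset.sum_congr rfl h1, Finset.sum_const, Finset.card_compl, Fintype.card_fin, nsmul_eq_mul,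
    Nat.cast_sub (by omega), ← hdim']
  have hd : (dim n k ν #S : ℝ) ≠ 0 := by
    intro h0
    rw [h0, zero_mul] at hdim'
    have hk' : (0 : ℝ) < k := by exact_mod_cast hk
    have hα' : (0 : ℝ) < alpha n k ν := by exact_mod_cast hα
    exact (mul_pos hk' hα').ne hdim'
  field_simp

/-! ### Decoding in the two-layer scheme -/

/-- The message word that the nodes encode when they are all asked for the projection onto `v`. -/
def message {α : ℕ} (v : Fin m × Fin α → F) (X : Files K m α k) (b : Fin k) : K :=
  ∑ p, algebraMap F K (v p) * X p.1 p.2 b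

/-- The symbol of the codeword of the message word `z` on node `l`. -/
def codeSymbol (G : Matrix (Fin k) (Fin n) F) (l : Fin n) (z : Fin k → K) : K :=
  ∑ b, algebraMap F K (G b l) * z b

omit [Fintype F] in
theorem message_add {α : ℕ} (v v' : Fin m × Fin α → F) (X : Files K m α k) :
    message (v + v') X = message v X + message v' X := by
  ext b
  simp [message, add_mul, Finset.sum_add_distrib]

omit [Fintype F] in
theorem message_unitVec {α : ℕ} (f : Fin m) (a : Fin α) (X : Files K m α k) :
    message (unitVec F m α f a) X = X f a := by
  ext b
  unfold message
  rw [Finset.sum_eq_single (f, a)]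
  · simp [unitVec]
  · rintro ⟨f', a'⟩ _ hne
    have : ¬ (f' = f ∧ a'.val = a.val) := fun h => hne (Prod.ext h.1 (Fin.ext h.2))
    simp [unitVec, this]
  · simp

omit [Fintype F] in
theorem sum_mul_stored {α : ℕ} (G : Matrix (Fin k) (Fin n) F) (v : Fin m × Fin α → F)
    (X : Files K m α k) (l : Fin n) :
    ∑ p, algebraMap F K (v p) * stored G X l p = codeSymbol G l (message v X) := by
  simp only [stored, codeSymbol, message, Finset.mul_sum]
  rw [Finset.sum_comm]
  exact Finset.sum_congr rfl fun b _ => Finset.sum_congr rfl fun p _ => by ring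

omit [Fintype F] in
theorem codeSymbol_sub (G : Matrix (Fin k) (Fin n) F) (l : Fin n) (z z' : Fin k → K) :
    codeSymbol G l (z - z') = codeSymbol G l z - codeSymbol G l z' := by
  simp [codeSymbol, mul_sub, Finset.sum_sub_distrib]

/-- The nodes that give information about the part `p`: the responsive nodes asked for it in
layer 1, and the nodes that replace the unresponsive ones in layer 2. -/
def informants (A : Plan n k ν S) (p : Part) : Finset (Fin n) :=
  {l ∈ askers n k ν p | l ∉ S} ∪
    (({x | x.part = p} : Finset (Missing n k ν S)).image fun x => (A.node x).1)

theorem card_askers_le_card_informants (A : Plan n k ν S) (p : Part) :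
    #(askers n k ν p) ≤ #(informants A p) := by
  have hdisj : Disjoint ({l ∈ askers n k ν p | l ∉ S} : Finset (Fin n))
      (({x | x.part = p} : Finset (Missing n k ν S)).image fun x => (A.node x).1) := by
    rw [Finset.disjoint_left]
    intro l hl hl'
    obtain ⟨x, hx, rfl⟩ := Finset.mem_image.1 hl'
    obtain ⟨t, ht⟩ := (Finset.mem_filter.1 (Finset.mem_filter.1 hl).1).2
    exact A.fresh_layer1 x t (ht.trans (Finset.mem_filter.1 hx).2.symm)
  have hcard : #{l ∈ askers n k ν p | l ∈ S} ≤ #{x : Missing n k ν S | x.part = p} := by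
    refine Finset.card_le_card_of_surjOn (fun x => x.2.1) fun l hl => ?_
    have hl' := Finset.mem_filter.1 (Finset.mem_coe.1 hl)
    obtain ⟨t, ht⟩ := (Finset.mem_filter.1 hl'.1).2
    exact ⟨(t, ⟨l, hl'.2⟩), Finset.mem_coe.2 (Finset.mem_filter.2 ⟨Finset.mem_univ _, ht⟩), rfl⟩
  unfold informants
  rw [Finset.card_union_of_disjoint hdisj, Finset.card_image_of_injOn,
    ← Finset.card_filter_add_card_filter_not (s := askers n k ν p) fun l => l ∈ S]
  · omega
  · intro x hx y hy hxy
    exact A.fresh_layer2 x y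
      ((Finset.mem_filter.1 hx).2.trans (Finset.mem_filter.1 hy).2.symm) (Subtype.ext hxy)

omit [Fintype F] in
theorem eq_zero_of_informants [DecidableEq F] {G : Matrix (Fin k) (Fin n) F} (hG : IsMDS G)
    (A : Plan n k ν S) {p : Part} (hp : #(askers n k ν p) = k) {z : Fin k → K}
    (h1 : ∀ (t : Fin (dim n k ν 0)) (l : Fin n), l ∉ S → part n k t l = p → codeSymbol G l z = 0)
    (h2 : ∀ x, x.part = p → codeSymbol G (A.node x).1 z = 0) : z = 0 := by
  refine hG.eq_zero_of_forall_mem (hp.ge.trans (card_askers_le_card_informants A p))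
    fun l hl => ?_
  rcases Finset.mem_union.1 hl with hl | hl
  · obtain ⟨hl, hlS⟩ := Finset.mem_filter.1 hl
    obtain ⟨t, ht⟩ := (Finset.mem_filter.1 hl).2
    exact h1 t l hlS ht
  · obtain ⟨x, hx, rfl⟩ := Finset.mem_image.1 hl
    exact h2 x (Finset.mem_filter.1 hx).2

omit [Fintype F] in
/-- Decoding, for the difference of two collections of files with the same answers: `δ v` is the
difference of the message words for the projection onto `v`. -/
theorem unitVec_eq_zero_of_answers [DecidableEq F] (hk : 0 < k) (hkn : k < n)
    (hS : #S + k ≤ n) {G : Matrix (Fin k) (Fin n) F} (hG : IsMDS G) (A : Plan n k ν S) (f : Fin m)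
    (U : Fin (dim n k ν 0) → Fin m × Fin (alpha n k ν) → F)
    (V : Fin (dim n k ν #S - dim n k ν 0) → Fin m × Fin (alpha n k ν) → F)
    (δ : (Fin m × Fin (alpha n k ν) → F) → Fin k → K) (hδ : ∀ v v', δ (v + v') = δ v + δ v')
    (h1 : ∀ t, ∀ l ∉ S, codeSymbol G l (δ (query1 f U t l)) = 0)
    (h2 : ∀ s, ∀ l ∉ S, codeSymbol G l (δ (query2 A f U V s l)) = 0) (a : Fin (alpha n k ν)) :
    δ (unitVec F m (alpha n k ν) f a) = 0 := by
  -- in each new subquery, `k` responsive nodes receive the random vector alone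
  have hV : ∀ s, δ (V s) = 0 := by
    intro s
    let B : Finset (Fin n) := ({x | A.group x = s} : Finset _).image fun x => (A.node x).1
    have hB : #B ≤ n - #S - k := by
      rw [← A.card_group s]; exact Finset.card_image_le
    refine hG.eq_zero_of_forall_mem (T := Sᶜ \ B) ?_ fun l hl => ?_
    · have h3 := Finset.le_card_sdiff B Sᶜ
      rw [Finset.card_compl, Fintype.card_fin] at h3
      omega
    · obtain ⟨hlS, hlB⟩ := Finset.mem_sdiff.1 hl
      have h3 := h2 s l (Finset.mem_compl.1 hlS)
      rwa [query2_of_forall_ne A f U V fun x hx hxl =>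
        hlB (Finset.mem_image.2 ⟨x, by simpa using hx, hxl⟩)] at h3
  have hhid : ∀ x, codeSymbol G (A.node x).1 (δ (hidden f U x)) = 0 := by
    intro x
    have h3 := h2 (A.group x) (A.node x) (A.node x).2
    rwa [query2_group_node, hδ, hV, zero_add] at h3
  have hU : ∀ t, δ (U t) = 0 := by
    intro t
    refine eq_zero_of_informants hG A (card_askers_mask hk hkn t) (fun t' l hl h => ?_)
      fun x hx => ?_
    · have ht : t' = t := Fin.ext (part_eq_mask h)
      have h3 := h1 t' l hl
      rwa [query1_of_mask f U h, ht] at h3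
    · have ht : x.1 = t := Fin.ext (part_eq_mask hx)
      have h3 := hhid x
      rwa [hidden_of_mask f U hx, ht] at h3
  refine eq_zero_of_informants hG A (card_askers_stripe hk hkn a.2) (fun t l hl h => ?_)
    fun x hx => ?_
  · have h3 := h1 t l hl
    rwa [query1_of_stripe f U h, hδ, hU, zero_add] at h3
  · have h3 := hhid x
    rwa [hidden_of_stripe f U hx] at h3

theorem scheme_query_castAdd (A : Fin m → Plan n k ν S) (f : Fin m) (ω : Masks F n k ν m #S)
    (l : Fin n) (t : Fin (dim n k ν 0)) :
    (scheme (F := F) S A).query f ω l (Fin.castAdd (extra n k ν S l) t) = query1 f ω.1 t l :=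
  Fin.addCases_left (motive := fun _ => Fin m × Fin (alpha n k ν) → F)
    (left := fun t => query1 f ω.1 t l)
    (right := fun s => query2 (A f) f ω.1 ω.2 (Fin.castLE (extra_le S l) s) l) t

theorem scheme_query_natAdd (A : Fin m → Plan n k ν S) (f : Fin m) (ω : Masks F n k ν m #S)
    (l : Fin n) (s : Fin (extra n k ν S l)) :
    (scheme (F := F) S A).query f ω l (Fin.natAdd (dim n k ν 0) s) =
      query2 (A f) f ω.1 ω.2 (Fin.castLE (extra_le S l) s) l :=
  Fin.addCases_right (motive := fun _ => Fin m × Fin (alpha n k ν) → F)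
    (left := fun t => query1 f ω.1 t l)
    (right := fun s => query2 (A f) f ω.1 ω.2 (Fin.castLE (extra_le S l) s) l) s

variable (K) in
theorem toPIRScheme_answer (G : Matrix (Fin k) (Fin n) F) {α : ℕ} (P : LinearPIRScheme F n m α)
    (l : Fin n) (q : Matrix (Fin (P.rows l)) (Fin m × Fin α) F) (X : Files K m α k)
    (i : Fin (P.rows l)) :
    (P.toPIRScheme K).answer l q (stored G X l) i = codeSymbol G l (message (q i) X) :=
  sum_mul_stored G (q i) X l

omit [Fintype F] in
/-- A scheme retrieves the file as soon as files with the same answers agree. -/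
theorem retrieves_of_forall_eq {α : ℕ} {P : PIRScheme.{v, w} K n m α}
    {G : Matrix (Fin k) (Fin n) F} {R : Finset (Fin n)}
    (h : ∀ f ω (X Y : Files K m α k), (∀ l ∈ R, P.answer l (P.query f ω l) (stored G X l) =
      P.answer l (P.query f ω l) (stored G Y l)) → X f = Y f) : P.Retrieves G R := by
  intro f ω _
  have hfac : Function.FactorsThrough (fun X : Files K m α k => X f)
      fun X (l : {l // l ∈ R}) => P.answer l (P.query f ω l) (stored G X l) :=
    fun X Y hXY => h f ω X Y fun l hl => congrFun hXY ⟨l, hl⟩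
  obtain ⟨dec, hdec⟩ := (Function.factorsThrough_iff _).1 hfac
  exact ⟨dec, fun X => (congrFun hdec X).symm⟩

variable (K) in
theorem scheme_retrieves [DecidableEq F] (hk : 0 < k) (hν : ν + k < n) (hS : #S ≤ ν)
    {G : Matrix (Fin k) (Fin n) F} (hG : IsMDS G) (A : Fin m → Plan n k ν S) :
    ((scheme (F := F) S A).toPIRScheme K).Retrieves G Sᶜ := by
  refine retrieves_of_forall_eq fun f (ω : Masks F n k ν m #S) X Y hXY => ?_
  have hrow : ∀ l ∉ S, ∀ i : Fin (dim n k ν 0 + extra n k ν S l),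
      codeSymbol G l (message ((scheme (F := F) S A).query f ω l i) X -
        message ((scheme (F := F) S A).query f ω l i) Y) = 0 := by
    intro l hl i
    have h := congrFun (hXY l (Finset.mem_compl.2 hl)) i
    rw [codeSymbol_sub, sub_eq_zero]
    exact (toPIRScheme_answer K G (scheme (F := F) S A) l _ X i).symm.trans
      (h.trans (toPIRScheme_answer K G (scheme (F := F) S A) l _ Y i))
  funext a
  have h := unitVec_eq_zero_of_answers hk (by omega) (by omega) hG (A f) f ω.1 ω.2
    (fun v => message v X - message v Y)
    (fun v v' => by rw [message_add, message_add]; abel)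
    (fun t l hl => by
      have h := hrow l hl (Fin.castAdd _ t)
      rwa [scheme_query_castAdd] at h)
    (fun s l hl => by
      have hex : extra n k ν S l = dim n k ν #S - dim n k ν 0 := if_neg hl
      have h := hrow l hl (Fin.natAdd _ (Fin.cast hex.symm s))
      rwa [scheme_query_natAdd] at h) a
  rw [message_unitVec, message_unitVec] at h
  exact sub_eq_zero.1 h

end TwoLayer

/-! ### Robustness and optimality of the two-layer scheme -/

theorem theorem1 {F : Type u} {K : Type v} [Field F] [Fintype F] [DecidableEq F] [Field K]
    [Fintype K] [Algebra F K] (n k ν : ℕ) (hk : 0 < k) (hν : ν + k < n)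
    (G : Matrix (Fin k) (Fin n) F) (hG : IsMDS G) :
    -- the choices of layer 2 can always be made
    (∀ S : Finset (Fin n), #S ≤ ν → Nonempty (TwoLayer.Plan n k ν S)) ∧
    -- whatever the choices are, the two-layer scheme is universal `ν`-robust
    (∀ (m : ℕ), 0 < m →
      ∀ A : (S : Finset (Fin n)) → #S ≤ ν → Fin m → TwoLayer.Plan n k ν S,
        IsUniversalRobust G ν fun S hS => (TwoLayer.scheme (F := F) S (A S hS)).toPIRScheme K) ∧
    -- its price of privacy is asymptotically optimal
    (∀ S : Finset (Fin n), #S ≤ ν →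
      IsAsymptoticLowerBound.{u, v, w} K G Sᶜ (((n : ℝ) - #S) / ((n : ℝ) - #S - k))) := by
  refine ⟨fun S hS => TwoLayer.nonempty_plan hk hν hS, fun m hm A S hS => ?_, fun S hS => ?_⟩
  · exact ⟨TwoLayer.scheme_isPrivate K hm (A S hS),
      TwoLayer.scheme_retrieves K hk hν hS hG (A S hS),
      TwoLayer.scheme_cPoP F K hk hν hS hm (A S hS)⟩
  · have hcard : #Sᶜ = n - #S := by rw [Finset.card_compl, Fintype.card_fin]
    have h := isAsymptoticLowerBound_of_isMDS.{u, v, w} (K := K) hk hG (R := Sᶜ) (by omega)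
    rwa [hcard, Nat.cast_sub (by omega)] at h
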